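/- Let $\Omega\subset\mathbb R^2$ be an open set with a conforming mesh $\Omega_h$ of finitely many non-overlapping convex quadrilaterals $K$ (tensor product elements, images of the unit square under bilinear maps), with mesh size $h=\max_K\operatorname{diam}K$. Assume that for a constant $\kappa>0$ the two edges meeting at any vertex of any element span a parallelogram of area at least $\kappa h^2$ (shape regularity and quasi-uniformity; every mesh satisfies this for some $\kappa>0$). Let $V_h$ be the space of discontinuous piecewise polynomials of order $p\ge 0$ (on each element either polynomials of total degree at most $p$, or tensor product polynomials of degree at most $p$ in each reference variable). On $\partial K$ let $n=n^-$ be the outward unit normal, let $(\cdot)^-$ denote the trace from $K$, and let $(\cdot)^+$ denote the trace from the neighbouring element, whose outward normal is $n^+=-n^-$; on $\partial\Omega$ the exterior values $\phi^+$ and $\vartheta^+\cdot n^+$ are $0$ (zero boundary condition). Let $(\cdot,\cdot)_K$ and $\langle\cdot,\cdot\rangle_{\partial K}$ be the $L^2$ inner products. Let $\Phi>0$, $\gamma\ge 0$, $\Delta t>0$, $f=f_0+\beta(y-y_m)$ with real constants $f_0,\beta,y_m$. The iHDG-II iterates for the homogeneous backward Euler HDG discretization of the linearized shallow water system are $(\phi^k,\vartheta^k)=(\phi^k,(u^k,v^k))\in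 V_h\times V_h^2$, $k\ge 0$, where the initial guess $(\phi^0,\vartheta^0)$ is arbitrary and, for every $k\ge0$, every element $K$ and all test functions $\varphi_1,\varphi_2,\varphi_3$ in the local polynomial space on $K$, $$\Big(\tfrac{\phi^{k+1}}{\Delta t},\varphi_1\Big)_K-(\Phi\vartheta^{k+1},\nabla\varphi_1)_K+\big\langle\Phi\vartheta^{k+1}\cdot n+\sqrt\Phi(\phi^{k+1}-\hat\phi^{k,k+1}),\varphi_1\big\rangle_{\partial K}=0,$$ $$\Big(\tfrac{\Phi u^{k+1}}{\Delta t},\varphi_2\Big)_K-(\Phi\phi^{k+1},\partial_x\varphi_2)_K+\langle\Phi\hat\phi^{k,k+1}n_1,\varphi_2\rangle_{\partial K}=(f\Phi v^{k+1}-\gamma\Phi u^{k+1},\varphi_2)_K,$$ $$\Big(\tfrac{\Phi v^{k+1}}{\Delta t},\varphi_3\Big)_K-(\Phi\phi^{k+1},\partial_y\varphi_3)_K+\langle\Phi\hat\phi^{k,k+1}n_2,\varphi_3\rangle_{\partial K}=(-f\Phi u^{k+1}-\gamma\Phi v^{k+1},\varphi_3)_K,$$ $$\hat\phi^{k,k+1}=\tfrac12\big\{(\phi^{k+1})^-+(\phi^k)^+\big\}+\tfrac{\sqrt\Phi}{2}\big\{(\vartheta^{k+1})^-\cdot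 n^-+(\vartheta^k)^+\cdot n^+\big\}.$$ Put $$\|(\phi,\vartheta)\|^2_{\Omega_h}=\sum_K\big(\|\phi\|^2_K+\Phi\|\vartheta\|^2_K\big),\qquad \|(\phi,\vartheta\cdot n)\|^2_{\mathcal E_h}=\sum_K\big(\|\phi^-\|^2_{\partial K}+\Phi\|\vartheta^-\cdot n^-\|^2_{\partial K}\big)$$ (so both one-sided traces count on an interior face), and, for constants $c\in(0,1]$ and $\varepsilon>0$, $$\mathcal A=\frac{\max\{1,\Phi\}+\sqrt\Phi}{4\varepsilon},\quad \mathcal G=\frac{\varepsilon(\max\{1,\Phi\}+\sqrt\Phi)}{4},\quad \mathcal B=\min\{\mathcal B_1,\mathcal B_2\},\quad \mathcal C=\frac{\mathcal A}{\mathcal B},$$ $$\mathcal B_1=\frac{ch}{\Delta t(p+1)(p+2)}+\frac{2\sqrt\Phi-(\Phi+\sqrt\Phi)\varepsilon}{4},\quad \mathcal B_2=\Big(\gamma+\frac1{\Delta t}\Big)\frac{ch}{(p+1)(p+2)}+\frac{2\sqrt\Phi-(1+\sqrt\Phi)\varepsilon}{4}.$$ Theorem. For every $\kappa>0$ there is a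 constant $c\in(0,1]$, depending only on $\kappa$, such that the following holds for all meshes as above with constant $\kappa$, all $p$, $\Delta t$, $\Phi$, $\gamma$, $f_0,\beta,y_m$ as above and all $\varepsilon>0$. If $\mathcal B>0$ and $\mathcal C<1$, then the iterates converge to zero in the following sense: $$\|(\phi^k,\vartheta^k\cdot n)\|^2_{\mathcal E_h}\le\mathcal C^k\,\|(\phi^0,\vartheta^0\cdot n)\|^2_{\mathcal E_h}\quad(k\ge0),$$ $$\|(\phi^k,\vartheta^k)\|^2_{\Omega_h}\le\Delta t\,(\mathcal A+\mathcal G\mathcal C)\,\mathcal C^{k-1}\,\|(\phi^0,\vartheta^0\cdot n)\|^2_{\mathcal E_h}\quad(k\ge1);$$ in particular both norms tend to $0$ as $k\to\infty$. -/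

import Mathlib

open MeasureTheory

noncomputable section

namespace IHDG

/-- The Euclidean plane. -/
abbrev Plane := EuclideanSpace ℝ (Fin 2)

/-- The two-dimensional cross product. -/
def cross (a b : Plane) : ℝ := a 0 * b 1 - a 1 * b 0

/-! ### Tensor product elements -/

/-- A nondegenerate convex quadrilateral, given by its four vertices in counterclockwise order:
the boundary turns strictly to the left at every vertex (indices are taken modulo `4`). -/
structure Quad where
  vert : Fin 4 → Plane
  convex : ∀ i, 0 < cross (vert (i + 1) - vert i) (vert (i + 2) - vert (i + 1))

namespace Quad

/-- The bilinear map from the reference square `[0,1]²` onto the quadrilateral. -/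
def bilin (K : Quad) (s t : ℝ) : Plane :=
  ((1 - s) * (1 - t)) • K.vert 0 + (s * (1 - t)) • K.vert 1 + (s * t) • K.vert 2
    + ((1 - s) * t) • K.vert 3

/-- The open element `K`. -/
def openElem (K : Quad) : Set Plane :=
  {x | ∃ s ∈ Set.Ioo (0 : ℝ) 1, ∃ t ∈ Set.Ioo (0 : ℝ) 1, x = K.bilin s t}

/-- The closed element. -/
def closedElem (K : Quad) : Set Plane :=
  {x | ∃ s ∈ Set.Icc (0 : ℝ) 1, ∃ t ∈ Set.Icc (0 : ℝ) 1, x = K.bilin s t}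

/-- The edge vector of the `i`-th edge, which runs from vertex `i` to vertex `i + 1`. -/
def edgeVec (K : Quad) (i : Fin 4) : Plane := K.vert (i + 1) - K.vert i

/-- The point with parameter `t ∈ [0,1]` on the `i`-th edge. -/
def edgePt (K : Quad) (i : Fin 4) (t : ℝ) : Plane := K.vert i + t • K.edgeVec i

/-- The relative interior of the `i`-th edge. -/
def openEdge (K : Quad) (i : Fin 4) : Set Plane := K.edgePt i '' Set.Ioo 0 1

/-- The outward unit normal vector on the `i`-th edge. -/
def normal (K : Quad) (i : Fin 4) : Plane :=
  ‖K.edgeVec i‖⁻¹ • !₂[K.edgeVec i 1, - K.edgeVec i 0]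

/-- The integral over `∂K` with respect to arc length of the function whose value at the point
`K.edgePt i t` of the `i`-th edge is `g i t`. -/
def bdryIntegral (K : Quad) (g : Fin 4 → ℝ → ℝ) : ℝ :=
  ∑ i, ‖K.edgeVec i‖ * ∫ t in (0 : ℝ)..1, g i t

end Quad

/-- The two usual polynomial spaces of order `p` on an element: polynomials in the physical
coordinates of total degree at most `p`, or (mapped) tensor product polynomials, of degree at
most `p` in each reference coordinate. -/
inductive PolyKind
  | total
  | tensor

/-- `f` restricted to the closed element `K` belongs to the local polynomial space of order `p`. -/
def Quad.InLocalSpace (K : Quad) (p : ℕ) : PolyKind → (Plane → ℝ) → Prop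
  | .total, f => ∃ q : MvPolynomial (Fin 2) ℝ, q.totalDegree ≤ p ∧
      ∀ x ∈ K.closedElem, f x = MvPolynomial.eval (fun i => x i) q
  | .tensor, f => ∃ q : MvPolynomial (Fin 2) ℝ, (∀ i, q.degreeOf i ≤ p) ∧
      ∀ s ∈ Set.Icc (0 : ℝ) 1, ∀ t ∈ Set.Icc (0 : ℝ) 1,
        f (K.bilin s t) = MvPolynomial.eval ![s, t] q

/-! ### Meshes -/

/-- A conforming mesh of an open set `Ω` of the plane by `N` non-overlapping convex quadrilaterals.
Every edge of an element is either an interior face, contained in `Ω` and equal to an edge of a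
neighbouring element (with the opposite orientation), or a boundary face, contained in `∂Ω`.
`nbr j i` is the neighbouring element across the `i`-th edge of element `j` together with the
number of the common edge in the neighbour, and `none` if the edge is a boundary face. -/
structure QuadMesh (N : ℕ) where
  Ω : Set Plane
  isOpen : IsOpen Ω
  elem : Fin N → Quad
  subset : ∀ j, (elem j).openElem ⊆ Ω
  closure_eq : closure Ω = ⋃ j, (elem j).closedElem
  disjoint : ∀ j j', j ≠ j' → Disjoint (elem j).openElem (elem j').openElem
  nbr : Fin N → Fin 4 → Option (Fin N × Fin 4)
  nbr_symm : ∀ j i j' i', nbr j i = some (j', i') → nbr j' i' = some (j, i)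
  nbr_vert : ∀ j i j' i', nbr j i = some (j', i') →
    (elem j').vert i' = (elem j).vert (i + 1) ∧ (elem j').vert (i' + 1) = (elem j).vert i
  nbr_interior : ∀ j i j' i', nbr j i = some (j', i') → (elem j).openEdge i ⊆ Ω
  nbr_boundary : ∀ j i, nbr j i = none → (elem j).openEdge i ⊆ frontier Ω

namespace QuadMesh

variable {N : ℕ} (T : QuadMesh N)

/-- The mesh size, the largest diameter of an element. -/
def meshSize : ℝ := ⨆ j, Metric.diam (T.elem j).closedElem

/-- Shape regularity and quasi-uniformity with constant `κ`: at each vertex of each element, the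
parallelogram spanned by the two adjacent edges has area at least `κ h²`. Every mesh satisfies
this for some `κ > 0`. -/
def IsRegular (κ : ℝ) : Prop :=
  ∀ j i, κ * T.meshSize ^ 2 ≤ cross ((T.elem j).edgeVec i) ((T.elem j).edgeVec (i + 1))

end QuadMesh

/-! ### The iteration -/

/-- Parameters of the linearized shallow water system, with Coriolis parameter
`f = f₀ + β (y - yₘ)`, and the time step `Δt`. -/
structure Params where
  Φ : ℝ
  γ : ℝ
  f₀ : ℝ
  β : ℝ
  yₘ : ℝ
  Δt : ℝ

/-- The Coriolis parameter. -/
def Params.coriolis (P : Params) (x : Plane) : ℝ := P.f₀ + P.β * (x 1 - P.yₘ)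

/-- Discontinuous fields `(φ, ϑ) = (φ, (u, v))`: one function for each element, of which only the
restriction to the closed element is relevant. -/
structure Fields (N : ℕ) where
  φ : Fin N → Plane → ℝ
  u : Fin N → Plane → ℝ
  v : Fin N → Plane → ℝ

/-- The `i`-th partial derivative. -/
def pd (i : Fin 2) (f : Plane → ℝ) (x : Plane) : ℝ := fderiv ℝ f x (EuclideanSpace.single i 1)

variable {N : ℕ}

/-- All components belong to the discontinuous piecewise polynomial space of order `p`. -/
def Fields.InVh (w : Fields N) (T : QuadMesh N) (kind : PolyKind) (p : ℕ) : Prop :=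
  ∀ j, (T.elem j).InLocalSpace p kind (w.φ j) ∧ (T.elem j).InLocalSpace p kind (w.u j) ∧
    (T.elem j).InLocalSpace p kind (w.v j)

/-- Interior trace `φ⁻` on the `i`-th edge of element `j`. -/
def Fields.phiMinus (w : Fields N) (T : QuadMesh N) (j : Fin N) (i : Fin 4) (t : ℝ) : ℝ :=
  w.φ j ((T.elem j).edgePt i t)

/-- Interior normal trace `ϑ⁻ · n⁻` on the `i`-th edge of element `j`. -/
def Fields.velMinus (w : Fields N) (T : QuadMesh N) (j : Fin N) (i : Fin 4) (t : ℝ) : ℝ :=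
  w.u j ((T.elem j).edgePt i t) * (T.elem j).normal i 0
    + w.v j ((T.elem j).edgePt i t) * (T.elem j).normal i 1

/-- Exterior trace `φ⁺` on the `i`-th edge of element `j`: the trace from the neighbour, or the
zero boundary value on a boundary face. -/
def Fields.phiPlus (w : Fields N) (T : QuadMesh N) (j : Fin N) (i : Fin 4) (t : ℝ) : ℝ :=
  match T.nbr j i with
  | none => 0
  | some (j', _) => w.φ j' ((T.elem j).edgePt i t)

/-- Exterior normal trace `ϑ⁺ · n⁺`, where `n⁺` is the outward normal of the neighbour, or the zero
boundary value on a boundary face. -/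
def Fields.velPlus (w : Fields N) (T : QuadMesh N) (j : Fin N) (i : Fin 4) (t : ℝ) : ℝ :=
  match T.nbr j i with
  | none => 0
  | some (j', i') => w.u j' ((T.elem j).edgePt i t) * (T.elem j').normal i' 0
      + w.v j' ((T.elem j).edgePt i t) * (T.elem j').normal i' 1

/-- The trace `φ̂^{k,k+1}` on `∂K_j`, computed from the new iterate inside and the old iterate
outside of the element. -/
def phiHat (P : Params) (T : QuadMesh N) (old new : Fields N) (j : Fin N) (i : Fin 4) (t : ℝ) : ℝ :=
  (new.phiMinus T j i t + old.phiPlus T j i t) / 2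
    + √P.Φ / 2 * (new.velMinus T j i t + old.velPlus T j i t)

/-- One step of iHDG-II: on each element `K = K_j` the new iterate solves the local backward Euler
HDG equations (with zero forcing and zero previous time level) for all test functions. -/
def IsStep (P : Params) (T : QuadMesh N) (kind : PolyKind) (p : ℕ) (old new : Fields N) : Prop :=
  ∀ j, ∀ ψ : Plane → ℝ, (T.elem j).InLocalSpace p kind ψ →
    ((∫ x in (T.elem j).openElem, new.φ j x / P.Δt * ψ x)
      - (∫ x in (T.elem j).openElem,
          (P.Φ * new.u j x * pd 0 ψ x + P.Φ * new.v j x * pd 1 ψ x))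
      + (T.elem j).bdryIntegral (fun i t =>
          (P.Φ * new.velMinus T j i t
            + √P.Φ * (new.phiMinus T j i t - phiHat P T old new j i t))
          * ψ ((T.elem j).edgePt i t)) = 0) ∧
    ((∫ x in (T.elem j).openElem, P.Φ * new.u j x / P.Δt * ψ x)
      - (∫ x in (T.elem j).openElem, P.Φ * new.φ j x * pd 0 ψ x)
      + (T.elem j).bdryIntegral (fun i t =>
          P.Φ * phiHat P T old new j i t * (T.elem j).normal i 0 * ψ ((T.elem j).edgePt i t))
      = ∫ x in (T.elem j).openElem,
          (P.coriolis x * P.Φ * new.v j x - P.γ * P.Φ * new.u j x) * ψ x) ∧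
    ((∫ x in (T.elem j).openElem, P.Φ * new.v j x / P.Δt * ψ x)
      - (∫ x in (T.elem j).openElem, P.Φ * new.φ j x * pd 1 ψ x)
      + (T.elem j).bdryIntegral (fun i t =>
          P.Φ * phiHat P T old new j i t * (T.elem j).normal i 1 * ψ ((T.elem j).edgePt i t))
      = ∫ x in (T.elem j).openElem,
          (- P.coriolis x * P.Φ * new.u j x - P.γ * P.Φ * new.v j x) * ψ x)

/-- `w 0, w 1, w 2, …` are the iterates of iHDG-II for some initial guess `w 0`. -/
def IsIteration (P : Params) (T : QuadMesh N) (kind : PolyKind) (p : ℕ) (w : ℕ → Fields N) : Prop :=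
  (∀ k, (w k).InVh T kind p) ∧ ∀ k, IsStep P T kind p (w k) (w (k + 1))

/-! ### Norms and constants -/

/-- `‖(φ, ϑ)‖²_{Ω_h} = ‖φ‖²_{Ω_h} + ‖ϑ‖²_{Φ,Ω_h}`. -/
def volNormSq (Φ : ℝ) (T : QuadMesh N) (w : Fields N) : ℝ :=
  ∑ j, ∫ x in (T.elem j).openElem, (w.φ j x ^ 2 + Φ * (w.u j x ^ 2 + w.v j x ^ 2))

/-- `‖(φ, ϑ · n)‖²_{E_h} = ‖φ‖²_{E_h} + ‖ϑ · n‖²_{Φ,E_h}`; on an interior face both one-sided traces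
contribute, so that this is the sum over all elements of the squared norms on `∂K`. -/
def skelNormSq (Φ : ℝ) (T : QuadMesh N) (w : Fields N) : ℝ :=
  ∑ j, (T.elem j).bdryIntegral
    (fun i t => w.phiMinus T j i t ^ 2 + Φ * w.velMinus T j i t ^ 2)

def constA (Φ ε : ℝ) : ℝ := (max 1 Φ + √Φ) / (4 * ε)

def constG (Φ ε : ℝ) : ℝ := ε * (max 1 Φ + √Φ) / 4

def constB₁ (P : Params) (c h : ℝ) (p : ℕ) (ε : ℝ) : ℝ :=
  c * h / (P.Δt * ((p : ℝ) + 1) * ((p : ℝ) + 2)) + (2 * √P.Φ - (P.Φ + √P.Φ) * ε) / 4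

def constB₂ (P : Params) (c h : ℝ) (p : ℕ) (ε : ℝ) : ℝ :=
  (P.γ + 1 / P.Δt) * (c * h / (((p : ℝ) + 1) * ((p : ℝ) + 2)))
    + (2 * √P.Φ - (1 + √P.Φ) * ε) / 4

def constB (P : Params) (c h : ℝ) (p : ℕ) (ε : ℝ) : ℝ :=
  min (constB₁ P c h p ε) (constB₂ P c h p ε)

def constC (P : Params) (c h : ℝ) (p : ℕ) (ε : ℝ) : ℝ := constA P.Φ ε / constB P c h p ε

end IHDG

end

noncomputable section

namespace IHDG

/-! ### A one-dimensional trace inequality for polynomials -/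

/-- Coefficients of the polynomial of degree `p` which represents the evaluation at `0` in
`L²(0,1)`; they come from a partial fraction decomposition. -/
theorem exists_kernel_coeff (p : ℕ) : ∃ a : ℕ → ℝ, a 0 = ((p : ℝ) + 1) ^ 2 ∧
    ∀ m ≤ p, ∑ j ∈ Finset.range (p + 1), a j / ((m : ℝ) + j + 1) = if m = 0 then 1 else 0 := by
  classical
  set s := Finset.range (p + 1) with hs
  set v : ℕ → ℝ := fun j => -((j : ℝ) + 1) with hv
  set f : Polynomial ℝ := Polynomial.C (((p : ℝ) + 1) * (-1) ^ p) *
    ∏ m ∈ Finset.range p, (Polynomial.X - Polynomial.C ((m : ℝ) + 1)) with hf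
  have hinj : Set.InjOn v s := by
    intro i _ j _ h
    simp only [hv, neg_inj, add_left_inj, Nat.cast_inj] at h
    exact h
  have hdeg : f.degree < s.card := by
    rw [hf, Polynomial.degree_C_mul (mul_ne_zero (by positivity) (by simp)),
      Polynomial.degree_prod]
    simp only [Polynomial.degree_X_sub_C, Finset.sum_const, Finset.card_range, hs]
    simp only [nsmul_eq_mul, mul_one]
    exact_mod_cast Nat.lt_succ_self p
  have hint := Lagrange.eq_interpolate hinj hdeg
  have hfe : ∀ x : ℝ, f.eval x = ((p : ℝ) + 1) * (-1) ^ p *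
      ∏ m ∈ Finset.range p, (x - ((m : ℝ) + 1)) := by
    intro x
    simp [hf, Polynomial.eval_prod]
  refine ⟨fun j => Lagrange.nodalWeight s v j * f.eval (v j), ?_, ?_⟩
  · have h1 : Lagrange.nodalWeight s v 0 = ∏ m ∈ Finset.range p, ((m : ℝ) + 1)⁻¹ := by
      rw [Lagrange.nodalWeight, hs, Finset.range_eq_Ico,
        ← Finset.insert_Ico_add_one_left_eq_Ico (Nat.succ_pos p), Finset.erase_insert (by simp),
        Finset.prod_Ico_eq_prod_range]
      refine Finset.prod_congr (by simp) fun m _ => ?_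
      simp only [hv]
      push_cast
      congr 1
      ring
    have h2 : f.eval (v 0) = ((p : ℝ) + 1) * ∏ m ∈ Finset.range p, ((m : ℝ) + 2) := by
      rw [hfe, mul_assoc]
      congr 1
      calc (-1 : ℝ) ^ p * ∏ m ∈ Finset.range p, (v 0 - ((m : ℝ) + 1))
          = ∏ m ∈ Finset.range p, ((-1) * (v 0 - ((m : ℝ) + 1))) := by
            rw [Finset.prod_mul_distrib, Finset.prod_const, Finset.card_range]
        _ = _ := by
            refine Finset.prod_congr rfl fun m _ => ?_
            simp only [hv]
            push_cast
            ring
    have h3 : ∀ n : ℕ, ∏ m ∈ Finset.range n, ((m : ℝ) + 2) =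
        ((n : ℝ) + 1) * ∏ m ∈ Finset.range n, ((m : ℝ) + 1) := by
      intro n
      induction n with
      | zero => simp
      | succ n ih =>
        rw [Finset.prod_range_succ, Finset.prod_range_succ, ih]
        push_cast
        ring
    have h4 : ∏ m ∈ Finset.range p, ((m : ℝ) + 1) ≠ 0 :=
      Finset.prod_ne_zero_iff.2 fun m _ => by positivity
    simp only [h1, h2, h3, Finset.prod_inv_distrib]
    field_simp
  · intro m hm
    have hx : ∀ i ∈ s, (m : ℝ) ≠ v i := by
      intro i _ h
      simp only [hv] at h
      have : (0 : ℝ) < (m : ℝ) + (i + 1) := by positivity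
      linarith
    have h := Lagrange.eval_interpolate_not_at_node (fun i => f.eval (v i)) hx
    rw [← hint] at h
    have hsum : ∑ j ∈ s, Lagrange.nodalWeight s v j * f.eval (v j) / ((m : ℝ) + j + 1) =
        ∑ i ∈ s, Lagrange.nodalWeight s v i * ((m : ℝ) - v i)⁻¹ * f.eval (v i) := by
      refine Finset.sum_congr rfl fun i _ => ?_
      have : (m : ℝ) - v i = m + i + 1 := by simp only [hv]; ring
      rw [this]
      ring
    have hn : (Lagrange.nodal s v).eval (m : ℝ) ≠ 0 := Lagrange.eval_nodal_not_at_node hx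
    rw [hsum]
    split_ifs with h0
    · have h5 : f.eval (m : ℝ) = (Lagrange.nodal s v).eval (m : ℝ) := by
        subst h0
        rw [hfe, Lagrange.eval_nodal, hs, Finset.prod_range_succ, mul_assoc, mul_comm]
        simp only [hv, Nat.cast_zero, zero_sub, neg_neg]
        congr 1
        rw [Finset.prod_neg, Finset.card_range, ← mul_assoc, ← mul_pow]
        simp
      rw [h5] at h
      exact mul_left_cancel₀ hn (by rw [← h, mul_one])
    · have h5 : f.eval (m : ℝ) = 0 := by
        rw [hfe, Finset.prod_eq_zero (i := m - 1) (by simp; omega), mul_zero]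
        have : 1 ≤ m := by omega
        push_cast [this]
        ring
      rw [h5] at h
      exact (mul_eq_zero.1 h.symm).resolve_left hn

theorem exists_eval_zero_kernel (p : ℕ) : ∃ k : Polynomial ℝ, k.natDegree ≤ p ∧
    k.eval 0 = ((p : ℝ) + 1) ^ 2 ∧
    ∀ q : Polynomial ℝ, q.natDegree ≤ p → ∫ x in (0 : ℝ)..1, k.eval x * q.eval x = q.eval 0 := by
  obtain ⟨a, ha0, ha⟩ := exists_kernel_coeff p
  refine ⟨∑ j ∈ Finset.range (p + 1), Polynomial.C (a j) * Polynomial.X ^ j, ?_, ?_, ?_⟩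
  · refine Polynomial.natDegree_sum_le_of_forall_le _ _ fun j hj => ?_
    exact (Polynomial.natDegree_C_mul_X_pow_le _ _).trans (by simp at hj; omega)
  · rw [Polynomial.eval_finsetSum, Finset.sum_range_succ']
    simp [ha0]
  · intro q hq
    have h1 : ∀ x : ℝ, (∑ j ∈ Finset.range (p + 1), Polynomial.C (a j) * Polynomial.X ^ j).eval x
        * q.eval x = ∑ m ∈ Finset.range (p + 1), ∑ j ∈ Finset.range (p + 1),
          q.coeff m * a j * x ^ (m + j) := by
      intro x
      rw [Polynomial.eval_finsetSum, Polynomial.eval_eq_sum_range' (Nat.lt_succ_of_le hq),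
        Finset.sum_mul_sum, Finset.sum_comm]
      refine Finset.sum_congr rfl fun m _ => Finset.sum_congr rfl fun j _ => ?_
      simp only [Polynomial.eval_mul, Polynomial.eval_C, Polynomial.eval_pow, Polynomial.eval_X]
      ring
    simp_rw [h1]
    rw [intervalIntegral.integral_finsetSum fun m _ =>
      (by fun_prop : Continuous _).intervalIntegrable _ _]
    have h2 : ∀ m ∈ Finset.range (p + 1), (∫ x in (0 : ℝ)..1, ∑ j ∈ Finset.range (p + 1),
        q.coeff m * a j * x ^ (m + j)) = q.coeff m * if m = 0 then 1 else 0 := by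
      intro m hm
      rw [intervalIntegral.integral_finsetSum fun m _ =>
        (by fun_prop : Continuous _).intervalIntegrable _ _,
        ← ha m (by simp at hm; omega), Finset.mul_sum]
      refine Finset.sum_congr rfl fun j _ => ?_
      rw [intervalIntegral.integral_const_mul, integral_pow]
      simp
      ring
    rw [Finset.sum_congr rfl h2, Finset.sum_range_succ']
    simp [Polynomial.coeff_zero_eq_eval_zero]

/-- The sharp trace inequality on the unit interval. -/
theorem sq_eval_zero_le (p : ℕ) (q : Polynomial ℝ) (hq : q.natDegree ≤ p) :
    q.eval 0 ^ 2 ≤ ((p : ℝ) + 1) ^ 2 * ∫ x in (0 : ℝ)..1, q.eval x ^ 2 := by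
  obtain ⟨k, hk, hk0, hkq⟩ := exists_eval_zero_kernel p
  set L : ℝ := ((p : ℝ) + 1) ^ 2 with hL
  have hLpos : 0 < L := by positivity
  have hc : ∀ r : Polynomial ℝ, Continuous fun x => r.eval x := fun r => r.continuous
  have h0 : 0 ≤ ∫ x in (0 : ℝ)..1, (L * q.eval x - q.eval 0 * k.eval x) ^ 2 :=
    intervalIntegral.integral_nonneg zero_le_one fun x _ => sq_nonneg _
  have h1 : (∫ x in (0 : ℝ)..1, (L * q.eval x - q.eval 0 * k.eval x) ^ 2) =
      L ^ 2 * (∫ x in (0 : ℝ)..1, q.eval x ^ 2)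
        - 2 * L * q.eval 0 * (∫ x in (0 : ℝ)..1, k.eval x * q.eval x)
        + q.eval 0 ^ 2 * ∫ x in (0 : ℝ)..1, k.eval x * k.eval x := by
    rw [← intervalIntegral.integral_const_mul, ← intervalIntegral.integral_const_mul,
      ← intervalIntegral.integral_const_mul, ← intervalIntegral.integral_sub,
      ← intervalIntegral.integral_add]
    · congr 1
      ext x
      ring
    all_goals exact Continuous.intervalIntegrable (by fun_prop) _ _
  rw [h1, hkq q hq, hkq k hk, hk0] at h0
  have h2 : 0 ≤ L * (L * (∫ x in (0 : ℝ)..1, q.eval x ^ 2) - q.eval 0 ^ 2) := by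
    linarith
  have := (mul_nonneg_iff_of_pos_left hLpos).1 h2
  linarith

theorem sq_eval_one_le (p : ℕ) (q : Polynomial ℝ) (hq : q.natDegree ≤ p) :
    q.eval 1 ^ 2 ≤ ((p : ℝ) + 1) ^ 2 * ∫ x in (0 : ℝ)..1, q.eval x ^ 2 := by
  have hd : (q.comp (1 - Polynomial.X)).natDegree ≤ p := by
    refine Polynomial.natDegree_comp_le.trans ?_
    have : (1 - Polynomial.X : Polynomial ℝ).natDegree ≤ 1 :=
      (Polynomial.natDegree_sub_le _ _).trans (by simp)
    nlinarith
  have h := sq_eval_zero_le p _ hd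
  have hi := intervalIntegral.integral_comp_sub_left (a := 0) (b := 1) (fun x => q.eval x ^ 2) 1
  simp only [Polynomial.eval_comp, Polynomial.eval_sub, Polynomial.eval_one, Polynomial.eval_X,
    sub_zero] at h
  simp only [sub_self, sub_zero] at hi
  rwa [hi] at h

/-! ### Polynomials in the reference coordinates -/

theorem exists_polynomial_section (p : ℕ) (q : MvPolynomial (Fin 2) ℝ)
    (hq : ∀ i, q.degreeOf i ≤ p) (i : Fin 2) (x : Fin 2 → ℝ) :
    ∃ r : Polynomial ℝ, r.natDegree ≤ p ∧
      ∀ s, r.eval s = MvPolynomial.eval (Function.update x i s) q := by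
  refine ⟨MvPolynomial.aeval (Function.update (fun k => Polynomial.C (x k)) i Polynomial.X) q,
    ?_, ?_⟩
  · rw [MvPolynomial.aeval_def, MvPolynomial.eval₂_eq']
    refine Polynomial.natDegree_sum_le_of_forall_le _ _ fun d hd => ?_
    refine (Polynomial.natDegree_C_mul_le _ _).trans ((Polynomial.natDegree_prod_le _ _).trans ?_)
    have hdi : d i ≤ p := (MvPolynomial.monomial_le_degreeOf i hd).trans (hq i)
    refine le_trans ?_ hdi
    rw [Finset.sum_eq_single i]
    · simp
    · intro k _ hk
      rw [Function.update_of_ne hk, ← Polynomial.C_pow, Polynomial.natDegree_C]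
    · simp
  · intro s
    rw [MvPolynomial.aeval_def, ← Polynomial.coe_evalRingHom, MvPolynomial.hom_eval₂,
      MvPolynomial.eval₂_eq', MvPolynomial.eval_eq']
    refine Finset.sum_congr rfl fun d _ => ?_
    congr 1
    · simp
    · refine Finset.prod_congr rfl fun k _ => ?_
      by_cases hk : k = i
      · subst hk; simp
      · simp [Function.update_of_ne hk]

/-- Polynomials of total degree at most `p` are mapped tensor product polynomials. -/
theorem Quad.InLocalSpace.tensor {K : Quad} {p : ℕ} {kind : PolyKind} {f : Plane → ℝ}
    (h : K.InLocalSpace p kind f) : K.InLocalSpace p .tensor f := by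
  cases kind with
  | tensor => exact h
  | total =>
    obtain ⟨q, hq, hf⟩ := h
    let S : MvPolynomial (Fin 2) ℝ := MvPolynomial.X 0
    let R : MvPolynomial (Fin 2) ℝ := MvPolynomial.X 1
    let F : Fin 2 → MvPolynomial (Fin 2) ℝ := fun i =>
      (1 - S) * (1 - R) * MvPolynomial.C (K.vert 0 i) + S * (1 - R) * MvPolynomial.C (K.vert 1 i)
        + S * R * MvPolynomial.C (K.vert 2 i) + (1 - S) * R * MvPolynomial.C (K.vert 3 i)
    have hX : ∀ i k : Fin 2, (MvPolynomial.X k : MvPolynomial (Fin 2) ℝ).degreeOf i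
        = if i = k then 1 else 0 := fun i k => by rw [MvPolynomial.degreeOf_X]
    have h1X : ∀ i k : Fin 2, (1 - MvPolynomial.X k : MvPolynomial (Fin 2) ℝ).degreeOf i
        ≤ if i = k then 1 else 0 := fun i k =>
      (MvPolynomial.degreeOf_sub_le _ _ _).trans (by simp [hX])
    have hF : ∀ k i, (F k).degreeOf i ≤ 1 := by
      have key : ∀ (A B : MvPolynomial (Fin 2) ℝ) (c : ℝ) (i : Fin 2),
          A.degreeOf i ≤ (if i = 0 then 1 else 0) → B.degreeOf i ≤ (if i = 1 then 1 else 0) →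
          (A * B * MvPolynomial.C c).degreeOf i ≤ 1 := by
        intro A B c i hA hB
        refine (MvPolynomial.degreeOf_mul_C_le _ _ _).trans
          ((MvPolynomial.degreeOf_mul_le _ _ _).trans ?_)
        fin_cases i <;> simp_all
      intro k i
      refine (MvPolynomial.degreeOf_add_le _ _ _).trans
        (max_le ?_ (key _ _ _ _ (h1X i 0) (hX i 1).le))
      refine (MvPolynomial.degreeOf_add_le _ _ _).trans
        (max_le ?_ (key _ _ _ _ (hX i 0).le (hX i 1).le))
      exact (MvPolynomial.degreeOf_add_le _ _ _).trans (max_le (key _ _ _ _ (h1X i 0) (h1X i 1))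
        (key _ _ _ _ (hX i 0).le (h1X i 1)))
    refine ⟨MvPolynomial.aeval F q, fun i => ?_, fun s hs t ht => ?_⟩
    · rw [MvPolynomial.aeval_def, MvPolynomial.eval₂_eq']
      refine (MvPolynomial.degreeOf_sum_le _ _ _).trans (Finset.sup_le fun d hd => ?_)
      refine (MvPolynomial.degreeOf_C_mul_le _ _ _).trans
        ((MvPolynomial.degreeOf_prod_le _ _ _).trans ?_)
      calc ∑ k, (F k ^ d k).degreeOf i ≤ ∑ k, d k := by
            refine Finset.sum_le_sum fun k _ => (MvPolynomial.degreeOf_pow_le _ _ _).trans ?_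
            exact (Nat.mul_le_mul_left _ (hF k i)).trans (by simp)
        _ = d.sum fun _ e => e := by rw [Finsupp.sum_fintype _ _ (fun _ => rfl)]
        _ ≤ q.totalDegree := MvPolynomial.le_totalDegree hd
        _ ≤ p := hq
    · rw [hf _ ⟨s, hs, t, ht, rfl⟩, MvPolynomial.aeval_def, MvPolynomial.hom_eval₂,
        MvPolynomial.eval₂_eq', MvPolynomial.eval_eq']
      refine Finset.sum_congr rfl fun d _ => ?_
      congr 1
      · simp
      · refine Finset.prod_congr rfl fun k _ => ?_
        congr 1
        simp [F, S, R, Quad.bilin]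

/-- A smooth function on the reference square which is polynomial of degree at most `p` in each
variable represents `f` in reference coordinates. -/
structure Quad.Rep (K : Quad) (p : ℕ) (f : Plane → ℝ) (q : ℝ × ℝ → ℝ) : Prop where
  contDiff : ContDiff ℝ 1 q
  eq : ∀ s ∈ Set.Icc (0 : ℝ) 1, ∀ t ∈ Set.Icc (0 : ℝ) 1, f (K.bilin s t) = q (s, t)
  left : ∀ t, ∃ r : Polynomial ℝ, r.natDegree ≤ p ∧ ∀ s, r.eval s = q (s, t)
  right : ∀ s, ∃ r : Polynomial ℝ, r.natDegree ≤ p ∧ ∀ t, r.eval t = q (s, t)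

theorem Quad.InLocalSpace.exists_rep {K : Quad} {p : ℕ} {kind : PolyKind} {f : Plane → ℝ}
    (h : K.InLocalSpace p kind f) : ∃ q, K.Rep p f q := by
  obtain ⟨q, hq, hf⟩ := h.tensor
  refine ⟨fun x => MvPolynomial.eval ![x.1, x.2] q, ?_, hf, fun t => ?_, fun s => ?_⟩
  · simp_rw [MvPolynomial.eval_eq']
    refine ContDiff.sum fun d _ => contDiff_const.mul ?_
    simp only [Fin.prod_univ_two, Matrix.cons_val_zero, Matrix.cons_val_one]
    fun_prop
  · obtain ⟨r, hr, h⟩ := exists_polynomial_section p q hq 0 ![0, t]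
    refine ⟨r, hr, fun s => (h s).trans ?_⟩
    congr 2
    ext i
    fin_cases i <;> simp
  · obtain ⟨r, hr, h⟩ := exists_polynomial_section p q hq 1 ![s, 0]
    refine ⟨r, hr, fun t => (h t).trans ?_⟩
    congr 2
    ext i
    fin_cases i <;> simp

/-! ### Reference coordinates -/

/-- The open reference square. -/
def refSquare : Set (ℝ × ℝ) := Set.Ioo 0 1 ×ˢ Set.Ioo 0 1

theorem isOpen_refSquare : IsOpen refSquare := isOpen_Ioo.prod isOpen_Ioo

theorem refSquare_ae_eq : refSquare =ᵐ[volume] Set.Icc (0 : ℝ × ℝ) 1 := by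
  have h : Set.Icc (0 : ℝ × ℝ) 1 = Set.Icc 0 1 ×ˢ Set.Icc 0 1 := Set.Icc_prod_eq 0 1
  rw [h]
  exact Measure.set_prod_ae_eq Ioo_ae_eq_Icc Ioo_ae_eq_Icc

theorem integrableOn_refSquare {g : ℝ × ℝ → ℝ} (hg : Continuous g) :
    IntegrableOn g refSquare :=
  (hg.continuousOn.integrableOn_compact (isCompact_Icc (a := (0 : ℝ × ℝ)) (b := 1))).congr_set_ae
    refSquare_ae_eq

theorem setIntegral_refSquare {g : ℝ × ℝ → ℝ} (hg : Continuous g) :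
    ∫ x in refSquare, g x = ∫ s in (0 : ℝ)..1, ∫ t in (0 : ℝ)..1, g (s, t) := by
  have := setIntegral_prod (μ := volume) (ν := volume) g (integrableOn_refSquare hg)
  rw [refSquare, Measure.volume_eq_prod, this]
  simp only [intervalIntegral.integral_of_le zero_le_one, integral_Ioc_eq_integral_Ioo]

theorem setIntegral_refSquare_swap {g : ℝ × ℝ → ℝ} (hg : Continuous g) :
    ∫ x in refSquare, g x = ∫ t in (0 : ℝ)..1, ∫ s in (0 : ℝ)..1, g (s, t) := by
  have := setIntegral_prod_swap (μ := (volume : Measure ℝ)) (ν := (volume : Measure ℝ))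
    (Set.Ioo 0 1) (Set.Ioo 0 1) g
  rw [refSquare, Measure.volume_eq_prod, ← this, ← Measure.volume_eq_prod]
  exact setIntegral_refSquare (hg.comp continuous_swap)

/-- The identification of `ℝ × ℝ` with the Euclidean plane. -/
def toPlane : (ℝ × ℝ) ≃L[ℝ] Plane :=
  (ContinuousLinearEquiv.finTwoArrow ℝ ℝ).symm.trans (EuclideanSpace.equiv (Fin 2) ℝ).symm

@[simp] theorem toPlane_zero (x : ℝ × ℝ) : toPlane x 0 = x.1 := rfl

@[simp] theorem toPlane_one (x : ℝ × ℝ) : toPlane x 1 = x.2 := rfl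

theorem measurePreserving_toPlane : MeasurePreserving toPlane volume volume :=
  (PiLp.volume_preserving_toLp (Fin 2)).comp ((volume_preserving_finTwoArrow ℝ).symm _)

theorem measurableEmbedding_toPlane : MeasurableEmbedding toPlane :=
  toPlane.toHomeomorph.measurableEmbedding

namespace Quad

variable (K : Quad)

/-- The bilinear map, in coordinates. -/
def refMap (x : ℝ × ℝ) : ℝ × ℝ := (K.bilin x.1 x.2 0, K.bilin x.1 x.2 1)

theorem toPlane_refMap (x : ℝ × ℝ) : toPlane (K.refMap x) = K.bilin x.1 x.2 := by
  ext i
  fin_cases i <;> rfl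

/-- The derivative of the bilinear map with respect to the first variable. -/
def ds (i : Fin 2) (x : ℝ × ℝ) : ℝ :=
  (1 - x.2) * (K.vert 1 i - K.vert 0 i) + x.2 * (K.vert 2 i - K.vert 3 i)

/-- The derivative of the bilinear map with respect to the second variable. -/
def dt (i : Fin 2) (x : ℝ × ℝ) : ℝ :=
  (1 - x.1) * (K.vert 3 i - K.vert 0 i) + x.1 * (K.vert 2 i - K.vert 1 i)

/-- The Jacobian determinant of the bilinear map. -/
def jac (x : ℝ × ℝ) : ℝ := K.ds 0 x * K.dt 1 x - K.dt 0 x * K.ds 1 x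

@[fun_prop] theorem contDiff_ds (i : Fin 2) : ContDiff ℝ 1 (K.ds i) := by
  unfold ds; fun_prop

@[fun_prop] theorem contDiff_dt (i : Fin 2) : ContDiff ℝ 1 (K.dt i) := by
  unfold dt; fun_prop

@[fun_prop] theorem continuous_ds (i : Fin 2) : Continuous (K.ds i) := (K.contDiff_ds i).continuous

@[fun_prop] theorem continuous_dt (i : Fin 2) : Continuous (K.dt i) := (K.contDiff_dt i).continuous

@[fun_prop] theorem continuous_jac : Continuous K.jac := by
  unfold jac; fun_prop

theorem le_jac {m : ℝ} (h : ∀ i, m ≤ cross (K.edgeVec i) (K.edgeVec (i + 1))) {x : ℝ × ℝ}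
    (hx : x ∈ refSquare) : m ≤ K.jac x := by
  obtain ⟨⟨hs0, hs1⟩, ht0, ht1⟩ := hx
  have e : K.jac x = (1 - x.1) * (1 - x.2) * cross (K.edgeVec 3) (K.edgeVec (3 + 1))
      + x.1 * (1 - x.2) * cross (K.edgeVec 0) (K.edgeVec (0 + 1))
      + x.1 * x.2 * cross (K.edgeVec 1) (K.edgeVec (1 + 1))
      + (1 - x.1) * x.2 * cross (K.edgeVec 2) (K.edgeVec (2 + 1)) := by
    have h31 : (3 : Fin 4) + 1 = 0 := rfl
    have h21 : (2 : Fin 4) + 1 = 3 := rfl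
    have h11 : (1 : Fin 4) + 1 = 2 := rfl
    simp only [jac, ds, dt, cross, edgeVec, PiLp.sub_apply, h31, h21, h11, zero_add]
    ring
  have h0 := mul_le_mul_of_nonneg_left (h 0) (by nlinarith : 0 ≤ x.1 * (1 - x.2))
  have h1 := mul_le_mul_of_nonneg_left (h 1) (by nlinarith : 0 ≤ x.1 * x.2)
  have h2 := mul_le_mul_of_nonneg_left (h 2) (by nlinarith : 0 ≤ (1 - x.1) * x.2)
  have h3 := mul_le_mul_of_nonneg_left (h 3) (by nlinarith : 0 ≤ (1 - x.1) * (1 - x.2))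
  rw [e]
  linarith

theorem cross_edgeVec_pos (i : Fin 4) : 0 < cross (K.edgeVec i) (K.edgeVec (i + 1)) := by
  have h := K.convex i
  have e : i + 1 + 1 = i + 2 := by rw [add_assoc]; rfl
  simpa only [edgeVec, e] using h

theorem jac_pos {x : ℝ × ℝ} (hx : x ∈ refSquare) : 0 < K.jac x := by
  obtain ⟨i, -, hi⟩ := Finset.exists_min_image Finset.univ
    (fun i => cross (K.edgeVec i) (K.edgeVec (i + 1))) Finset.univ_nonempty
  exact (K.cross_edgeVec_pos i).trans_le (K.le_jac (fun k => hi k (Finset.mem_univ k)) hx)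

theorem norm_edgeVec_pos (i : Fin 4) : 0 < ‖K.edgeVec i‖ := by
  rw [norm_pos_iff]
  intro h
  have := K.cross_edgeVec_pos i
  simp [h, cross] at this

/-- The derivative of `refMap`. -/
def refDeriv (x : ℝ × ℝ) : ℝ × ℝ →L[ℝ] ℝ × ℝ :=
  (Matrix.toLin (.finTwoProd ℝ) (.finTwoProd ℝ)
    !![K.ds 0 x, K.dt 0 x; K.ds 1 x, K.dt 1 x]).toContinuousLinearMap

theorem det_refDeriv (x : ℝ × ℝ) : (K.refDeriv x).det = K.jac x := by
  simp only [refDeriv, LinearMap.det_toContinuousLinearMap, LinearMap.det_toLin,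
    Matrix.det_fin_two_of, jac]

theorem refDeriv_apply (x y : ℝ × ℝ) : K.refDeriv x y =
    (K.ds 0 x * y.1 + K.dt 0 x * y.2, K.ds 1 x * y.1 + K.dt 1 x * y.2) := by
  simp [refDeriv, Matrix.toLin_finTwoProd_apply]

theorem hasStrictFDerivAt_bilin (i : Fin 2) (x : ℝ × ℝ) :
    HasStrictFDerivAt (fun y : ℝ × ℝ => K.bilin y.1 y.2 i)
      (K.ds i x • ContinuousLinearMap.fst ℝ ℝ ℝ + K.dt i x • ContinuousLinearMap.snd ℝ ℝ ℝ) x := by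
  have hs : HasStrictFDerivAt (fun y : ℝ × ℝ => y.1) (ContinuousLinearMap.fst ℝ ℝ ℝ) x :=
    hasStrictFDerivAt_fst
  have ht : HasStrictFDerivAt (fun y : ℝ × ℝ => y.2) (ContinuousLinearMap.snd ℝ ℝ ℝ) x :=
    hasStrictFDerivAt_snd
  have h := (((((hs.const_sub 1).mul (ht.const_sub 1)).mul_const (K.vert 0 i)).add
    ((hs.mul (ht.const_sub 1)).mul_const (K.vert 1 i))).add
    ((hs.mul ht).mul_const (K.vert 2 i))).add (((hs.const_sub 1).mul ht).mul_const (K.vert 3 i))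
  refine (h.congr_fderiv ?_).congr_of_eventuallyEq ?_
  · ext <;> simp [ds, dt] <;> ring
  · refine Filter.Eventually.of_forall fun y => ?_
    simp [bilin]

theorem hasStrictFDerivAt_refMap (x : ℝ × ℝ) :
    HasStrictFDerivAt K.refMap (K.refDeriv x) x := by
  refine ((K.hasStrictFDerivAt_bilin 0 x).prodMk (K.hasStrictFDerivAt_bilin 1 x)).congr_fderiv ?_
  ext <;> simp [refDeriv_apply]

theorem injOn_refMap : Set.InjOn K.refMap refSquare := by
  intro x hx y hy h
  set m : ℝ × ℝ := ((x.1 + y.1) / 2, (x.2 + y.2) / 2) with hm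
  have hmem : m ∈ refSquare := by
    obtain ⟨⟨a, b⟩, c, d⟩ := hx
    obtain ⟨⟨a', b'⟩, c', d'⟩ := hy
    refine ⟨⟨?_, ?_⟩, ?_, ?_⟩ <;> simp only [hm] <;> linarith
  have key : ∀ i, K.ds i m * (x.1 - y.1) + K.dt i m * (x.2 - y.2) =
      K.bilin x.1 x.2 i - K.bilin y.1 y.2 i := by
    intro i
    simp only [ds, dt, hm, bilin, PiLp.add_apply, PiLp.smul_apply, smul_eq_mul]
    ring
  have h0 : K.bilin x.1 x.2 0 = K.bilin y.1 y.2 0 := congrArg Prod.fst h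
  have h1 : K.bilin x.1 x.2 1 = K.bilin y.1 y.2 1 := congrArg Prod.snd h
  have k0 := key 0
  have k1 := key 1
  rw [h0, sub_self] at k0
  rw [h1, sub_self] at k1
  have hj := (K.jac_pos hmem).ne'
  have e1 : K.jac m * (x.1 - y.1) = 0 := by
    simp only [jac]
    linear_combination K.dt 1 m * k0 - K.dt 0 m * k1
  have e2 : K.jac m * (x.2 - y.2) = 0 := by
    simp only [jac]
    linear_combination K.ds 0 m * k1 - K.ds 1 m * k0
  ext
  · exact sub_eq_zero.1 ((mul_eq_zero.1 e1).resolve_left hj)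
  · exact sub_eq_zero.1 ((mul_eq_zero.1 e2).resolve_left hj)

theorem openElem_eq : K.openElem = toPlane '' (K.refMap '' refSquare) := by
  ext z
  rw [Set.image_image]
  constructor
  · rintro ⟨s, hs, t, ht, rfl⟩
    exact ⟨(s, t), ⟨hs, ht⟩, K.toPlane_refMap _⟩
  · rintro ⟨x, hx, rfl⟩
    exact ⟨x.1, hx.1, x.2, hx.2, K.toPlane_refMap _⟩

theorem setIntegral_openElem (G : Plane → ℝ) :
    ∫ x in K.openElem, G x = ∫ x in refSquare, K.jac x * G (K.bilin x.1 x.2) := by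
  rw [openElem_eq, measurePreserving_toPlane.setIntegral_image_emb measurableEmbedding_toPlane,
    integral_image_eq_integral_abs_det_fderiv_smul volume isOpen_refSquare.measurableSet
      (fun x _ => (K.hasStrictFDerivAt_refMap x).hasFDerivAt.hasFDerivWithinAt) K.injOn_refMap]
  refine setIntegral_congr_fun isOpen_refSquare.measurableSet fun x hx => ?_
  simp only [det_refDeriv, abs_of_pos (K.jac_pos hx), toPlane_refMap, smul_eq_mul]

theorem integrableOn_openElem {G : Plane → ℝ} {g : ℝ × ℝ → ℝ} (hg : Continuous g)
    (h : ∀ x ∈ refSquare, K.jac x * G (K.bilin x.1 x.2) = g x) : IntegrableOn G K.openElem := by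
  rw [openElem_eq, measurePreserving_toPlane.integrableOn_image measurableEmbedding_toPlane,
    integrableOn_image_iff_integrableOn_abs_det_fderiv_smul volume isOpen_refSquare.measurableSet
      (fun x _ => (K.hasStrictFDerivAt_refMap x).hasFDerivAt.hasFDerivWithinAt) K.injOn_refMap]
  refine (integrableOn_refSquare hg).congr_fun (fun x hx => ?_) isOpen_refSquare.measurableSet
  simp only [det_refDeriv, abs_of_pos (K.jac_pos hx), Function.comp_apply, toPlane_refMap,
    smul_eq_mul, h x hx]

end Quad

namespace Quad.Rep

variable {K : Quad} {p : ℕ} {f g : Plane → ℝ} {q r : ℝ × ℝ → ℝ}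

theorem eq_of_mem (h : K.Rep p f q) {x : ℝ × ℝ} (hx : x ∈ refSquare) :
    f (K.bilin x.1 x.2) = q x :=
  h.eq x.1 (Set.Ioo_subset_Icc_self hx.1) x.2 (Set.Ioo_subset_Icc_self hx.2)

/-- The chain rule for the bilinear map. -/
theorem exists_hasFDerivAt (h : K.Rep p f q) {x : ℝ × ℝ} (hx : x ∈ refSquare) :
    ∃ L : ℝ × ℝ →L[ℝ] ℝ, HasFDerivAt (f ∘ toPlane) L (K.refMap x) ∧
      L.comp (K.refDeriv x) = fderiv ℝ q x := by
  have hdet : (K.refDeriv x).det ≠ 0 := by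
    rw [Quad.det_refDeriv]; exact (K.jac_pos hx).ne'
  set e := (K.refDeriv x).toContinuousLinearEquivOfDetNeZero hdet with he
  have hF : HasStrictFDerivAt K.refMap (e : ℝ × ℝ →L[ℝ] ℝ × ℝ) x := by
    rw [he, ContinuousLinearMap.coe_toContinuousLinearEquivOfDetNeZero]
    exact K.hasStrictFDerivAt_refMap x
  have hq : HasFDerivAt q (fderiv ℝ q x) (hF.localInverse K.refMap e x (K.refMap x)) := by
    rw [hF.localInverse_apply_image]
    exact (h.contDiff.differentiable one_ne_zero x).hasFDerivAt
  refine ⟨_, (hq.comp (K.refMap x) hF.to_localInverse.hasFDerivAt).congr_of_eventuallyEq ?_, ?_⟩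
  · filter_upwards [hF.eventually_right_inverse,
      hF.localInverse_tendsto.eventually (isOpen_refSquare.mem_nhds hx)] with y hy hmem
    rw [Function.comp_apply, Function.comp_apply, ← h.eq_of_mem hmem, ← Quad.toPlane_refMap, hy]
  · have hee : K.refDeriv x = (e : ℝ × ℝ →L[ℝ] ℝ × ℝ) := by
      rw [he, ContinuousLinearMap.coe_toContinuousLinearEquivOfDetNeZero]
    rw [hee]
    ext <;> simp

theorem jac_mul_pd (h : K.Rep p f q) {x : ℝ × ℝ} (hx : x ∈ refSquare) :
    K.jac x * pd 0 f (K.bilin x.1 x.2) =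
        fderiv ℝ q x (1, 0) * K.dt 1 x - fderiv ℝ q x (0, 1) * K.ds 1 x ∧
      K.jac x * pd 1 f (K.bilin x.1 x.2) =
        fderiv ℝ q x (0, 1) * K.ds 0 x - fderiv ℝ q x (1, 0) * K.dt 0 x := by
  obtain ⟨L, hL, hc⟩ := h.exists_hasFDerivAt hx
  have hf : HasFDerivAt f (L.comp (toPlane.symm : Plane →L[ℝ] ℝ × ℝ)) (K.bilin x.1 x.2) := by
    rw [← K.toPlane_refMap]
    exact toPlane.comp_right_hasFDerivAt_iff'.1 hL
  have e0 : toPlane.symm (EuclideanSpace.single 0 1) = ((1 : ℝ), (0 : ℝ)) := by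
    rw [ContinuousLinearEquiv.symm_apply_eq]
    ext i; fin_cases i <;> simp
  have e1 : toPlane.symm (EuclideanSpace.single 1 1) = ((0 : ℝ), (1 : ℝ)) := by
    rw [ContinuousLinearEquiv.symm_apply_eq]
    ext i; fin_cases i <;> simp
  have hlin : ∀ a b : ℝ, L (a, b) = a * L (1, 0) + b * L (0, 1) := by
    intro a b
    have : ((a, b) : ℝ × ℝ) = a • (1, 0) + b • (0, 1) := by simp
    rw [this, map_add, map_smul, map_smul, smul_eq_mul, smul_eq_mul]
  simp only [pd, hf.fderiv, ← hc, ContinuousLinearMap.comp_apply, Quad.refDeriv_apply,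
    ContinuousLinearEquiv.coe_coe, e0, e1, mul_one, mul_zero, add_zero, zero_add,
    hlin (K.ds 0 x), hlin (K.dt 0 x), Quad.jac]
  constructor <;> ring

end Quad.Rep

namespace Quad

variable (K : Quad)

/-! ### Traces -/

/-- The reference coordinates of the point with parameter `t` on the `i`-th edge. -/
def edgeParam (i : Fin 4) (t : ℝ) : ℝ × ℝ := ![(t, 0), (1, t), (1 - t, 1), (0, 1 - t)] i

theorem continuous_edgeParam (i : Fin 4) : Continuous (edgeParam i) := by
  unfold edgeParam
  fin_cases i
  · exact continuous_id.prodMk continuous_const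
  · exact continuous_const.prodMk continuous_id
  · exact (continuous_const.sub continuous_id).prodMk continuous_const
  · exact continuous_const.prodMk (continuous_const.sub continuous_id)

theorem edgeParam_mem (i : Fin 4) {t : ℝ} (ht : t ∈ Set.Icc (0 : ℝ) 1) :
    (edgeParam i t).1 ∈ Set.Icc (0 : ℝ) 1 ∧ (edgeParam i t).2 ∈ Set.Icc (0 : ℝ) 1 := by
  obtain ⟨h0, h1⟩ := ht
  fin_cases i <;> simp [edgeParam, h0, h1]

theorem edgePt_eq_bilin (i : Fin 4) (t : ℝ) :
    K.edgePt i t = K.bilin (edgeParam i t).1 (edgeParam i t).2 := by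
  have h31 : (3 : Fin 4) + 1 = 0 := rfl
  have h21 : (2 : Fin 4) + 1 = 3 := rfl
  ext k
  fin_cases i <;> simp [edgePt, edgeVec, edgeParam, bilin, h31, h21] <;> ring

theorem Rep.edge {K : Quad} {p : ℕ} {f : Plane → ℝ} {q : ℝ × ℝ → ℝ} (h : K.Rep p f q)
    (i : Fin 4) {t : ℝ} (ht : t ∈ Set.Icc (0 : ℝ) 1) : f (K.edgePt i t) = q (edgeParam i t) := by
  rw [edgePt_eq_bilin]
  exact h.eq _ (edgeParam_mem i ht).1 _ (edgeParam_mem i ht).2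

theorem Rep.continuousOn_edge {K : Quad} {p : ℕ} {f : Plane → ℝ} {q : ℝ × ℝ → ℝ}
    (h : K.Rep p f q) (i : Fin 4) :
    ContinuousOn (fun t => f (K.edgePt i t)) (Set.Icc 0 1) :=
  (h.contDiff.continuous.comp (continuous_edgeParam i)).continuousOn.congr fun _ ht => h.edge i ht

theorem norm_mul_normal (i : Fin 4) :
    ‖K.edgeVec i‖ * K.normal i 0 = K.edgeVec i 1 ∧
      ‖K.edgeVec i‖ * K.normal i 1 = - K.edgeVec i 0 := by
  have := (K.norm_edgeVec_pos i).ne'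
  simp only [normal, PiLp.smul_apply, smul_eq_mul]
  constructor <;> rw [mul_inv_cancel_left₀ this] <;> simp

theorem normal_sq (i : Fin 4) : K.normal i 0 ^ 2 + K.normal i 1 ^ 2 = 1 := by
  have h := K.norm_mul_normal i
  have hp := K.norm_edgeVec_pos i
  have hn : ‖K.edgeVec i‖ ^ 2 = K.edgeVec i 0 ^ 2 + K.edgeVec i 1 ^ 2 := by
    rw [EuclideanSpace.norm_sq_eq]
    simp
  rw [← h.1, ← neg_sq, ← neg_sq (K.edgeVec i 0)] at hn
  rw [← h.2] at hn
  have : ‖K.edgeVec i‖ ^ 2 * (K.normal i 0 ^ 2 + K.normal i 1 ^ 2) = ‖K.edgeVec i‖ ^ 2 * 1 := by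
    linear_combination -hn
  exact mul_left_cancel₀ (by positivity) this

theorem intervalIntegrable_of_continuousOn {g : ℝ → ℝ} (hg : ContinuousOn g (Set.Icc 0 1)) :
    IntervalIntegrable g volume 0 1 :=
  ContinuousOn.intervalIntegrable (by rwa [Set.uIcc_of_le zero_le_one])

theorem bdryIntegral_add {g g' : Fin 4 → ℝ → ℝ} (hg : ∀ i, ContinuousOn (g i) (Set.Icc 0 1))
    (hg' : ∀ i, ContinuousOn (g' i) (Set.Icc 0 1)) :
    K.bdryIntegral (fun i t => g i t + g' i t) = K.bdryIntegral g + K.bdryIntegral g' := by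
  simp only [bdryIntegral, ← Finset.sum_add_distrib]
  refine Finset.sum_congr rfl fun i _ => ?_
  rw [intervalIntegral.integral_add (intervalIntegrable_of_continuousOn (hg i))
    (intervalIntegrable_of_continuousOn (hg' i)), mul_add]

theorem bdryIntegral_const_mul (c : ℝ) (g : Fin 4 → ℝ → ℝ) :
    K.bdryIntegral (fun i t => c * g i t) = c * K.bdryIntegral g := by
  simp only [bdryIntegral, Finset.mul_sum]
  refine Finset.sum_congr rfl fun i _ => ?_
  rw [intervalIntegral.integral_const_mul]
  ring

theorem bdryIntegral_mono {g g' : Fin 4 → ℝ → ℝ} (hg : ∀ i, ContinuousOn (g i) (Set.Icc 0 1))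
    (hg' : ∀ i, ContinuousOn (g' i) (Set.Icc 0 1))
    (h : ∀ i, ∀ t ∈ Set.Icc (0 : ℝ) 1, g i t ≤ g' i t) :
    K.bdryIntegral g ≤ K.bdryIntegral g' :=
  Finset.sum_le_sum fun i _ => mul_le_mul_of_nonneg_left
    (intervalIntegral.integral_mono_on zero_le_one (intervalIntegrable_of_continuousOn (hg i))
      (intervalIntegrable_of_continuousOn (hg' i)) (h i)) (norm_nonneg _)

theorem bdryIntegral_nonneg {g : Fin 4 → ℝ → ℝ}
    (h : ∀ i, ∀ t ∈ Set.Icc (0 : ℝ) 1, 0 ≤ g i t) : 0 ≤ K.bdryIntegral g :=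
  Finset.sum_nonneg fun i _ => mul_nonneg (norm_nonneg _)
    (intervalIntegral.integral_nonneg zero_le_one (h i))

/-! ### Integration by parts -/

namespace Rep

variable {K : Quad} {p : ℕ} {f g : Plane → ℝ} {q r : ℝ × ℝ → ℝ}

theorem continuous_fderiv_apply (h : K.Rep p f q) (v : ℝ × ℝ) :
    Continuous fun x => fderiv ℝ q x v :=
  (h.contDiff.continuous_fderiv one_ne_zero).clm_apply continuous_const

theorem integrableOn_mul (hf : K.Rep p f q) (hg : K.Rep p g r) :
    IntegrableOn (fun x => f x * g x) K.openElem := by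
  have hq := hf.contDiff.continuous
  have hr := hg.contDiff.continuous
  refine K.integrableOn_openElem (g := fun x => K.jac x * (q x * r x)) (by fun_prop) fun x hx => ?_
  rw [hf.eq_of_mem hx, hg.eq_of_mem hx]

theorem integrableOn_mul_pd (hf : K.Rep p f q) (hg : K.Rep p g r) (k : Fin 2) :
    IntegrableOn (fun x => f x * pd k g x) K.openElem := by
  have hq := hf.contDiff.continuous
  have h10 := hg.continuous_fderiv_apply (1, 0)
  have h01 := hg.continuous_fderiv_apply (0, 1)
  fin_cases k
  · refine K.integrableOn_openElem (g := fun x => q x *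
      (fderiv ℝ r x (1, 0) * K.dt 1 x - fderiv ℝ r x (0, 1) * K.ds 1 x)) (by fun_prop)
      fun x hx => ?_
    rw [hf.eq_of_mem hx, ← (hg.jac_mul_pd hx).1]
    simp only [Fin.zero_eta]
    ring
  · refine K.integrableOn_openElem (g := fun x => q x *
      (fderiv ℝ r x (0, 1) * K.ds 0 x - fderiv ℝ r x (1, 0) * K.dt 0 x)) (by fun_prop)
      fun x hx => ?_
    rw [hf.eq_of_mem hx, ← (hg.jac_mul_pd hx).2]
    simp only [Fin.mk_one]
    ring

theorem fderiv_ds (i : Fin 2) (x : ℝ × ℝ) : fderiv ℝ (K.ds i) x (0, 1) =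
    K.vert 0 i - K.vert 1 i + K.vert 2 i - K.vert 3 i := by
  have ht : HasFDerivAt (fun y : ℝ × ℝ => y.2) (ContinuousLinearMap.snd ℝ ℝ ℝ) x := hasFDerivAt_snd
  have h : HasFDerivAt (K.ds i) _ x := ((ht.const_sub 1).mul_const (K.vert 1 i - K.vert 0 i)).add
    (ht.mul_const (K.vert 2 i - K.vert 3 i))
  rw [h.fderiv]
  simp
  ring

theorem fderiv_dt (i : Fin 2) (x : ℝ × ℝ) : fderiv ℝ (K.dt i) x (1, 0) =
    K.vert 0 i - K.vert 1 i + K.vert 2 i - K.vert 3 i := by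
  have ht : HasFDerivAt (fun y : ℝ × ℝ => y.1) (ContinuousLinearMap.fst ℝ ℝ ℝ) x := hasFDerivAt_fst
  have h : HasFDerivAt (K.dt i) _ x := ((ht.const_sub 1).mul_const (K.vert 3 i - K.vert 0 i)).add
    (ht.mul_const (K.vert 2 i - K.vert 1 i))
  rw [h.fderiv]
  simp
  ring

/-- The divergence theorem on the reference square for the Piola transform of a multiple `w` of a
coordinate field. -/
theorem integral_piola {w : ℝ × ℝ → ℝ} (hw : ContDiff ℝ 1 w) (i : Fin 2) :
    ∫ x in refSquare, (fderiv ℝ w x (1, 0) * K.dt i x - fderiv ℝ w x (0, 1) * K.ds i x) =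
      ∑ k, K.edgeVec k i * ∫ t in (0 : ℝ)..1, w (edgeParam k t) := by
  have hA : ContDiff ℝ 1 fun x => w x * K.dt i x := hw.mul (K.contDiff_dt i)
  have hB : ContDiff ℝ 1 fun x => -(w x * K.ds i x) := (hw.mul (K.contDiff_ds i)).neg
  have hdw : ∀ x, DifferentiableAt ℝ w x := hw.differentiable one_ne_zero
  have hdA := hA.differentiable one_ne_zero
  have hdB := hB.differentiable one_ne_zero
  have hcont : Continuous fun x => fderiv ℝ (fun x => w x * K.dt i x) x (1, 0)
      + fderiv ℝ (fun x => -(w x * K.ds i x)) x (0, 1) :=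
    ((hA.continuous_fderiv one_ne_zero).clm_apply continuous_const).add
      ((hB.continuous_fderiv one_ne_zero).clm_apply continuous_const)
  have h := integral_divergence_prod_Icc_of_hasFDerivAt_off_countable_of_le
    (fun x => w x * K.dt i x) (fun x => -(w x * K.ds i x)) _ _ (0 : ℝ × ℝ) 1 zero_le_one
    ∅ Set.countable_empty hA.continuous.continuousOn hB.continuous.continuousOn
    (fun x _ => (hdA x).hasFDerivAt) (fun x _ => (hdB x).hasFDerivAt)
    (hcont.continuousOn.integrableOn_compact isCompact_Icc)
  rw [← setIntegral_congr_set refSquare_ae_eq] at h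
  have e : ∀ x, fderiv ℝ (fun x => w x * K.dt i x) x (1, 0)
      + fderiv ℝ (fun x => -(w x * K.ds i x)) x (0, 1) =
      fderiv ℝ w x (1, 0) * K.dt i x - fderiv ℝ w x (0, 1) * K.ds i x := by
    intro x
    have h1 := ((hdw x).hasFDerivAt.mul
      ((K.contDiff_dt i).differentiable one_ne_zero x).hasFDerivAt).fderiv
    have h2 := ((hdw x).hasFDerivAt.mul
      ((K.contDiff_ds i).differentiable one_ne_zero x).hasFDerivAt).neg.fderiv
    erw [h1, h2]
    simp [fderiv_ds, fderiv_dt]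
    ring
  simp_rw [e] at h
  rw [h]
  have h31 : (3 : Fin 4) + 1 = 0 := rfl
  have h21 : (2 : Fin 4) + 1 = 3 := rfl
  have c2 := intervalIntegral.integral_comp_sub_left (a := 0) (b := 1) (fun x => w (x, 1)) 1
  have c3 := intervalIntegral.integral_comp_sub_left (a := 0) (b := 1) (fun x => w (0, x)) 1
  simp only [sub_self, sub_zero] at c2 c3
  simp only [Fin.sum_univ_four, edgeParam, edgeVec, PiLp.sub_apply, h31, h21, ds, dt,
    Prod.fst_zero, Prod.snd_zero, Prod.fst_one, Prod.snd_one, sub_zero, sub_self, zero_mul, one_mul,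
    add_zero, zero_add, intervalIntegral.integral_neg, intervalIntegral.integral_mul_const,
    Matrix.cons_val, c2, c3]
  simp
  ring

/-- Integration by parts on an element. -/
theorem integral_mul_pd_add (hf : K.Rep p f q) (hg : K.Rep p g r) (k : Fin 2) :
    (∫ x in K.openElem, f x * pd k g x) + (∫ x in K.openElem, g x * pd k f x) =
      K.bdryIntegral fun i t => f (K.edgePt i t) * g (K.edgePt i t) * K.normal i k := by
  have hw : ContDiff ℝ 1 fun x => q x * r x := hf.contDiff.mul hg.contDiff
  have hfd : ∀ x v, fderiv ℝ (fun x => q x * r x) x v =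
      q x * fderiv ℝ r x v + r x * fderiv ℝ q x v := by
    intro x v
    have := ((hf.contDiff.differentiable one_ne_zero x).hasFDerivAt.mul
      (hg.contDiff.differentiable one_ne_zero x).hasFDerivAt).fderiv
    erw [this]
    simp
  have hb : ∀ i, (∫ t in (0 : ℝ)..1, f (K.edgePt i t) * g (K.edgePt i t)) =
      ∫ t in (0 : ℝ)..1, q (edgeParam i t) * r (edgeParam i t) := by
    intro i
    refine intervalIntegral.integral_congr fun t ht => ?_
    rw [Set.uIcc_of_le zero_le_one] at ht
    simp only [hf.edge i ht, hg.edge i ht]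
  rw [← integral_add (hf.integrableOn_mul_pd hg k) (hg.integrableOn_mul_pd hf k),
    K.setIntegral_openElem]
  simp only [bdryIntegral, intervalIntegral.integral_mul_const, hb]
  fin_cases k
  · rw [setIntegral_congr_fun isOpen_refSquare.measurableSet (g := fun x =>
      fderiv ℝ (fun x => q x * r x) x (1, 0) * K.dt 1 x
        - fderiv ℝ (fun x => q x * r x) x (0, 1) * K.ds 1 x), integral_piola hw]
    · refine Finset.sum_congr rfl fun i _ => ?_
      rw [← (K.norm_mul_normal i).1]
      simp only [Fin.zero_eta]
      ring
    · intro x hx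
      have h1 := (hf.jac_mul_pd hx).1
      have h2 := (hg.jac_mul_pd hx).1
      simp only [hfd, hf.eq_of_mem hx, hg.eq_of_mem hx, Fin.zero_eta]
      linear_combination r x * h1 + q x * h2
  · rw [setIntegral_congr_fun isOpen_refSquare.measurableSet (g := fun x =>
      -(fderiv ℝ (fun x => q x * r x) x (1, 0) * K.dt 0 x
        - fderiv ℝ (fun x => q x * r x) x (0, 1) * K.ds 0 x)), integral_neg, integral_piola hw,
      ← Finset.sum_neg_distrib]
    · refine Finset.sum_congr rfl fun i _ => ?_
      rw [← neg_mul, ← (K.norm_mul_normal i).2]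
      simp only [Fin.mk_one]
      ring
    · intro x hx
      have h1 := (hf.jac_mul_pd hx).2
      have h2 := (hg.jac_mul_pd hx).2
      simp only [hfd, hf.eq_of_mem hx, hg.eq_of_mem hx, Fin.mk_one]
      linear_combination r x * h1 + q x * h2

/-! ### The trace inequality -/

theorem integral_edge_sq_le (hf : K.Rep p f q) (i : Fin 4) :
    ∫ t in (0 : ℝ)..1, f (K.edgePt i t) ^ 2 ≤
      ((p : ℝ) + 1) ^ 2 * ∫ x in refSquare, q x ^ 2 := by
  have hq := hf.contDiff.continuous
  have hq2 : Continuous fun x => q x ^ 2 := hq.pow 2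
  have hb : (∫ t in (0 : ℝ)..1, f (K.edgePt i t) ^ 2) =
      ∫ t in (0 : ℝ)..1, q (edgeParam i t) ^ 2 := by
    refine intervalIntegral.integral_congr fun t ht => ?_
    rw [Set.uIcc_of_le zero_le_one] at ht
    simp only [hf.edge i ht]
  have hl0 : ∀ t, q (0, t) ^ 2 ≤ ((p : ℝ) + 1) ^ 2 * ∫ s in (0 : ℝ)..1, q (s, t) ^ 2 := fun t => by
    obtain ⟨a, ha, h⟩ := hf.left t
    simpa only [h] using sq_eval_zero_le p a ha
  have hl1 : ∀ t, q (1, t) ^ 2 ≤ ((p : ℝ) + 1) ^ 2 * ∫ s in (0 : ℝ)..1, q (s, t) ^ 2 := fun t => by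
    obtain ⟨a, ha, h⟩ := hf.left t
    simpa only [h] using sq_eval_one_le p a ha
  have hr0 : ∀ s, q (s, 0) ^ 2 ≤ ((p : ℝ) + 1) ^ 2 * ∫ t in (0 : ℝ)..1, q (s, t) ^ 2 := fun s => by
    obtain ⟨a, ha, h⟩ := hf.right s
    simpa only [h] using sq_eval_zero_le p a ha
  have hr1 : ∀ s, q (s, 1) ^ 2 ≤ ((p : ℝ) + 1) ^ 2 * ∫ t in (0 : ℝ)..1, q (s, t) ^ 2 := fun s => by
    obtain ⟨a, ha, h⟩ := hf.right s
    simpa only [h] using sq_eval_one_le p a ha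
  have c2 := intervalIntegral.integral_comp_sub_left (a := 0) (b := 1) (fun x => q (x, 1) ^ 2) 1
  have c3 := intervalIntegral.integral_comp_sub_left (a := 0) (b := 1) (fun x => q (0, x) ^ 2) 1
  simp only [sub_self, sub_zero] at c2 c3
  have hI1 : Continuous fun t => ((p : ℝ) + 1) ^ 2 * ∫ s in (0 : ℝ)..1, q (s, t) ^ 2 :=
    continuous_const.mul
      (intervalIntegral.continuous_parametric_intervalIntegral_of_continuous' (by fun_prop) _ _)
  have hI2 : Continuous fun s => ((p : ℝ) + 1) ^ 2 * ∫ t in (0 : ℝ)..1, q (s, t) ^ 2 :=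
    continuous_const.mul
      (intervalIntegral.continuous_parametric_intervalIntegral_of_continuous' (by fun_prop) _ _)
  have mono : ∀ a b : ℝ → ℝ, Continuous a → Continuous b → (∀ t, a t ≤ b t) →
      ∫ t in (0 : ℝ)..1, a t ≤ ∫ t in (0 : ℝ)..1, b t := fun a b ha hb h =>
    intervalIntegral.integral_mono zero_le_one (ha.intervalIntegrable _ _)
      (hb.intervalIntegrable _ _) h
  rw [hb]
  fin_cases i
  · rw [setIntegral_refSquare hq2, ← intervalIntegral.integral_const_mul]
    exact mono _ _ (by simp [edgeParam]; fun_prop) hI2 hr0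
  · rw [setIntegral_refSquare_swap hq2, ← intervalIntegral.integral_const_mul]
    exact mono _ _ (by simp [edgeParam]; fun_prop) hI1 hl1
  · rw [setIntegral_refSquare hq2, ← intervalIntegral.integral_const_mul]
    exact c2.le.trans (mono _ _ (by fun_prop) hI2 hr1)
  · rw [setIntegral_refSquare_swap hq2, ← intervalIntegral.integral_const_mul]
    exact c3.le.trans (mono _ _ (by fun_prop) hI1 hl0)

theorem integral_sq_le {m : ℝ} (hf : K.Rep p f q)
    (hm : ∀ i, m ≤ cross (K.edgeVec i) (K.edgeVec (i + 1))) :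
    m * ∫ x in refSquare, q x ^ 2 ≤ ∫ x in K.openElem, f x ^ 2 := by
  have hq := hf.contDiff.continuous
  have e : ∫ x in refSquare, K.jac x * f (K.bilin x.1 x.2) ^ 2 =
      ∫ x in refSquare, K.jac x * q x ^ 2 :=
    setIntegral_congr_fun isOpen_refSquare.measurableSet fun x hx => by
      simp only [hf.eq_of_mem hx]
  rw [K.setIntegral_openElem, e, ← integral_const_mul]
  exact setIntegral_mono_on (integrableOn_refSquare (by fun_prop))
    (integrableOn_refSquare (by fun_prop)) isOpen_refSquare.measurableSet
    fun x hx => mul_le_mul_of_nonneg_right (K.le_jac hm hx) (sq_nonneg _)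

/-- The discrete trace inequality on an element of a shape regular mesh. -/
theorem trace_le {κ h c : ℝ} (hf : K.Rep p f q) (hh : 0 < h) (hc : 0 ≤ c) (hcκ : 4 * c ≤ κ)
    (hlen : ∀ i, ‖K.edgeVec i‖ ≤ h)
    (hm : ∀ i, κ * h ^ 2 ≤ cross (K.edgeVec i) (K.edgeVec (i + 1))) :
    c * h / (((p : ℝ) + 1) * ((p : ℝ) + 2)) * K.bdryIntegral (fun i t => f (K.edgePt i t) ^ 2) ≤
      ∫ x in K.openElem, f x ^ 2 := by
  set I := ∫ x in refSquare, q x ^ 2 with hI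
  have hI0 : 0 ≤ I := integral_nonneg fun x => sq_nonneg _
  have hb : K.bdryIntegral (fun i t => f (K.edgePt i t) ^ 2) ≤
      4 * (h * (((p : ℝ) + 1) ^ 2 * I)) := by
    refine (Finset.sum_le_sum (g := fun _ => h * (((p : ℝ) + 1) ^ 2 * I)) fun i _ => ?_).trans
      (by simp)
    exact mul_le_mul (hlen i) (hf.integral_edge_sq_le i)
      (intervalIntegral.integral_nonneg zero_le_one fun _ _ => sq_nonneg _) hh.le
  refine le_trans ?_ (hf.integral_sq_le hm)
  have hp : (0 : ℝ) ≤ p := p.cast_nonneg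
  calc c * h / (((p : ℝ) + 1) * ((p : ℝ) + 2)) * K.bdryIntegral (fun i t => f (K.edgePt i t) ^ 2)
      ≤ c * h / (((p : ℝ) + 1) * ((p : ℝ) + 2)) * (4 * (h * (((p : ℝ) + 1) ^ 2 * I))) :=
        mul_le_mul_of_nonneg_left hb (by positivity)
    _ = 4 * c * (((p : ℝ) + 1) / ((p : ℝ) + 2)) * (h ^ 2 * I) := by
        field_simp
    _ ≤ 4 * c * 1 * (h ^ 2 * I) := by
        gcongr
        rw [div_le_one (by positivity)]
        linarith
    _ ≤ κ * (h ^ 2 * I) := by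
        rw [mul_one]
        gcongr
    _ = κ * h ^ 2 * I := by ring

end Rep

end Quad

/-! ### The energy identity on an element -/

theorem Quad.continuous_coriolis_bilin (K : Quad) (P : Params) :
    Continuous fun x : ℝ × ℝ => P.coriolis (K.bilin x.1 x.2) := by
  simp only [Params.coriolis, Quad.bilin, PiLp.add_apply, PiLp.smul_apply, smul_eq_mul]
  fun_prop

theorem Quad.bdryIntegral_flux_add (K : Quad) (Φ S : ℝ) (m n : Fin 4 → ℝ)
    {x y z ψ : Fin 4 → ℝ → ℝ} (hx : ∀ i, ContinuousOn (x i) (Set.Icc 0 1))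
    (hy : ∀ i, ContinuousOn (y i) (Set.Icc 0 1)) (hz : ∀ i, ContinuousOn (z i) (Set.Icc 0 1))
    (hψ : ∀ i, ContinuousOn (ψ i) (Set.Icc 0 1)) :
    K.bdryIntegral (fun i t =>
        (Φ * (y i t * m i + z i t * n i) + S * (x i t - ψ i t)) * x i t)
      + K.bdryIntegral (fun i t => Φ * ψ i t * m i * y i t)
      + K.bdryIntegral (fun i t => Φ * ψ i t * n i * z i t) =
      Φ * (K.bdryIntegral (fun i t => y i t * x i t * m i)
        + K.bdryIntegral (fun i t => z i t * x i t * n i))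
      + K.bdryIntegral (fun i t => S * (x i t - ψ i t) * x i t
        + Φ * ψ i t * (y i t * m i + z i t * n i)) := by
  rw [← K.bdryIntegral_add, ← K.bdryIntegral_add, ← K.bdryIntegral_add,
    ← K.bdryIntegral_const_mul, ← K.bdryIntegral_add]
  · congr 1
    ext i t
    ring
  all_goals
    intro i
    have := hx i
    have := hy i
    have := hz i
    have := hψ i
    fun_prop

/-- The energy identity of the local solver, obtained by testing with the solution itself. -/
theorem Quad.energy_identity (K : Quad) (P : Params) {p : ℕ} {φ u v : Plane → ℝ}
    {a b c : ℝ × ℝ → ℝ} (hφ : K.Rep p φ a) (hu : K.Rep p u b) (hv : K.Rep p v c)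
    {ψ : Fin 4 → ℝ → ℝ} (hψ : ∀ i, ContinuousOn (ψ i) (Set.Icc 0 1))
    (h₁ : (∫ x in K.openElem, φ x / P.Δt * φ x)
      - (∫ x in K.openElem, (P.Φ * u x * pd 0 φ x + P.Φ * v x * pd 1 φ x))
      + K.bdryIntegral (fun i t =>
          (P.Φ * (u (K.edgePt i t) * K.normal i 0 + v (K.edgePt i t) * K.normal i 1)
            + √P.Φ * (φ (K.edgePt i t) - ψ i t)) * φ (K.edgePt i t)) = 0)
    (h₂ : (∫ x in K.openElem, P.Φ * u x / P.Δt * u x)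
      - (∫ x in K.openElem, P.Φ * φ x * pd 0 u x)
      + K.bdryIntegral (fun i t => P.Φ * ψ i t * K.normal i 0 * u (K.edgePt i t))
      = ∫ x in K.openElem, (P.coriolis x * P.Φ * v x - P.γ * P.Φ * u x) * u x)
    (h₃ : (∫ x in K.openElem, P.Φ * v x / P.Δt * v x)
      - (∫ x in K.openElem, P.Φ * φ x * pd 1 v x)
      + K.bdryIntegral (fun i t => P.Φ * ψ i t * K.normal i 1 * v (K.edgePt i t))
      = ∫ x in K.openElem, (- P.coriolis x * P.Φ * u x - P.γ * P.Φ * v x) * v x) :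
    1 / P.Δt * (∫ x in K.openElem, φ x ^ 2)
      + (P.γ + 1 / P.Δt) * (P.Φ * ((∫ x in K.openElem, u x ^ 2) + ∫ x in K.openElem, v x ^ 2))
      + K.bdryIntegral (fun i t => √P.Φ * (φ (K.edgePt i t) - ψ i t) * φ (K.edgePt i t)
        + P.Φ * ψ i t * (u (K.edgePt i t) * K.normal i 0 + v (K.edgePt i t) * K.normal i 1))
      = 0 := by
  have cφ := hφ.continuousOn_edge
  have cu := hu.continuousOn_edge
  have cv := hv.continuousOn_edge
  have sqInt : ∀ (f : Plane → ℝ) (r : ℝ), (∫ x in K.openElem, r * f x / P.Δt * f x) =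
      r / P.Δt * ∫ x in K.openElem, f x ^ 2 := by
    intro f r
    rw [← integral_const_mul]
    congr 1
    ext x
    ring
  have sqφ := sqInt φ 1
  simp only [one_mul] at sqφ
  have iW : IntegrableOn (fun x => P.coriolis x * (v x * u x)) K.openElem := by
    have := K.continuous_coriolis_bilin P
    have := hu.contDiff.continuous
    have := hv.contDiff.continuous
    refine K.integrableOn_openElem (g := fun x =>
      K.jac x * (P.coriolis (K.bilin x.1 x.2) * (c x * b x))) (by fun_prop) fun x hx => ?_
    rw [hu.eq_of_mem hx, hv.eq_of_mem hx]
  have iuu : IntegrableOn (fun x => u x ^ 2) K.openElem := by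
    simpa only [pow_two] using hu.integrableOn_mul hu
  have ivv : IntegrableOn (fun x => v x ^ 2) K.openElem := by
    simpa only [pow_two] using hv.integrableOn_mul hv
  have d₁ : (∫ x in K.openElem, (P.Φ * u x * pd 0 φ x + P.Φ * v x * pd 1 φ x)) =
      P.Φ * ((∫ x in K.openElem, u x * pd 0 φ x) + ∫ x in K.openElem, v x * pd 1 φ x) := by
    rw [← integral_add (hu.integrableOn_mul_pd hφ 0) (hv.integrableOn_mul_pd hφ 1),
      ← integral_const_mul]
    congr 1
    ext x
    ring
  have d₂ : ∀ (f : Plane → ℝ) (k : Fin 2), (∫ x in K.openElem, P.Φ * φ x * pd k f x) =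
      P.Φ * ∫ x in K.openElem, φ x * pd k f x := by
    intro f k
    rw [← integral_const_mul]
    congr 1
    ext x
    ring
  have r₂ : (∫ x in K.openElem, (P.coriolis x * P.Φ * v x - P.γ * P.Φ * u x) * u x) =
      P.Φ * (∫ x in K.openElem, P.coriolis x * (v x * u x))
        - P.γ * P.Φ * ∫ x in K.openElem, u x ^ 2 := by
    rw [← integral_const_mul, ← integral_const_mul,
      ← integral_sub (iW.const_mul _) (iuu.const_mul _)]
    congr 1
    ext x
    ring
  have r₃ : (∫ x in K.openElem, (- P.coriolis x * P.Φ * u x - P.γ * P.Φ * v x) * v x) =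
      -P.Φ * (∫ x in K.openElem, P.coriolis x * (v x * u x))
        - P.γ * P.Φ * ∫ x in K.openElem, v x ^ 2 := by
    rw [← integral_const_mul, ← integral_const_mul,
      ← integral_sub (iW.const_mul _) (ivv.const_mul _)]
    congr 1
    ext x
    ring
  have p₀ := hu.integral_mul_pd_add hφ 0
  have p₁ := hv.integral_mul_pd_add hφ 1
  have hb := K.bdryIntegral_flux_add P.Φ √P.Φ (fun i => K.normal i 0) (fun i => K.normal i 1)
    cφ cu cv hψ
  rw [sqφ, d₁] at h₁
  rw [sqInt, d₂, r₂] at h₂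
  rw [sqInt, d₂, r₃] at h₃
  linear_combination h₁ + h₂ + h₃ - hb + P.Φ * p₀ + P.Φ * p₁

/-- The Young inequality for the numerical flux. -/
theorem flux_lower_bound {Φ ε : ℝ} (hΦ : 0 < Φ) (hε : 0 < ε) (x y x' y' : ℝ) :
    (2 * √Φ - (Φ + √Φ) * ε) / 4 * x ^ 2 + (2 * √Φ - (1 + √Φ) * ε) / 4 * (Φ * y ^ 2)
      ≤ √Φ * (x - ((x + x') / 2 + √Φ / 2 * (y + y'))) * x
        + Φ * ((x + x') / 2 + √Φ / 2 * (y + y')) * y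
        + constA Φ ε * (x' ^ 2 + Φ * y' ^ 2) := by
  obtain ⟨S, hS, hS0⟩ : ∃ S, √Φ = S ∧ 0 < S := ⟨_, rfl, Real.sqrt_pos.2 hΦ⟩
  have hΦS : Φ = S ^ 2 := by rw [← hS, Real.sq_sqrt hΦ.le]
  have hA : (Φ + S) / (4 * ε) * x' ^ 2 + (1 + S) / (4 * ε) * (Φ * y' ^ 2) ≤
      constA Φ ε * (x' ^ 2 + Φ * y' ^ 2) := by
    rw [mul_add, constA, hS]
    gcongr
    · exact le_max_right _ _
    · exact le_max_left _ _
  have key : √Φ * (x - ((x + x') / 2 + √Φ / 2 * (y + y'))) * x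
        + Φ * ((x + x') / 2 + √Φ / 2 * (y + y')) * y
        + ((Φ + S) / (4 * ε) * x' ^ 2 + (1 + S) / (4 * ε) * (Φ * y' ^ 2))
        - ((2 * √Φ - (Φ + √Φ) * ε) / 4 * x ^ 2 + (2 * √Φ - (1 + √Φ) * ε) / 4 * (Φ * y ^ 2))
      = S / (4 * ε) * (ε * x - x') ^ 2 + Φ / (4 * ε) * (ε * x - y') ^ 2
        + Φ / (4 * ε) * (ε * y + x') ^ 2 + Φ * S / (4 * ε) * (ε * y + y') ^ 2 := by
    rw [hS, hΦS]
    field_simp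
    ring
  have : 0 ≤ S / (4 * ε) * (ε * x - x') ^ 2 + Φ / (4 * ε) * (ε * x - y') ^ 2
        + Φ / (4 * ε) * (ε * y + x') ^ 2 + Φ * S / (4 * ε) * (ε * y + y') ^ 2 := by positivity
  linarith

/-! ### Traces on the mesh -/

variable {N : ℕ}

namespace QuadMesh

variable (T : QuadMesh N)

theorem norm_edgeVec_le (j : Fin N) (i : Fin 4) : ‖(T.elem j).edgeVec i‖ ≤ T.meshSize := by
  have hmem : ∀ i t, t ∈ Set.Icc (0 : ℝ) 1 → (T.elem j).edgePt i t ∈ (T.elem j).closedElem := by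
    intro i t ht
    rw [Quad.edgePt_eq_bilin]
    exact ⟨_, (Quad.edgeParam_mem i ht).1, _, (Quad.edgeParam_mem i ht).2, rfl⟩
  have hb : Bornology.IsBounded (T.elem j).closedElem := by
    have hc : Continuous fun x : ℝ × ℝ => (T.elem j).bilin x.1 x.2 := by
      unfold Quad.bilin
      fun_prop
    have : (T.elem j).closedElem =
        (fun x : ℝ × ℝ => (T.elem j).bilin x.1 x.2) '' (Set.Icc 0 1 ×ˢ Set.Icc 0 1) := by
      ext z
      constructor
      · rintro ⟨s, hs, t, ht, rfl⟩
        exact ⟨(s, t), ⟨hs, ht⟩, rfl⟩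
      · rintro ⟨x, hx, rfl⟩
        exact ⟨x.1, hx.1, x.2, hx.2, rfl⟩
    rw [this]
    exact ((isCompact_Icc.prod isCompact_Icc).image hc).isBounded
  have h1 := Metric.dist_le_diam_of_mem hb (hmem i 1 (by simp)) (hmem i 0 (by simp))
  have h2 : Metric.diam (T.elem j).closedElem ≤ T.meshSize :=
    le_ciSup (f := fun j => Metric.diam (T.elem j).closedElem) (Set.finite_range _).bddAbove j
  refine le_trans ?_ (h1.trans h2)
  simp [Quad.edgePt, dist_eq_norm]

theorem edgePt_nbr {j : Fin N} {i : Fin 4} {j' : Fin N} {i' : Fin 4}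
    (h : T.nbr j i = some (j', i')) (t : ℝ) :
    (T.elem j).edgePt i t = (T.elem j').edgePt i' (1 - t) := by
  obtain ⟨h1, h2⟩ := T.nbr_vert j i j' i' h
  simp only [Quad.edgePt, Quad.edgeVec, h1, h2]
  module

theorem norm_edgeVec_nbr {j : Fin N} {i : Fin 4} {j' : Fin N} {i' : Fin 4}
    (h : T.nbr j i = some (j', i')) : ‖(T.elem j).edgeVec i‖ = ‖(T.elem j').edgeVec i'‖ := by
  obtain ⟨h1, h2⟩ := T.nbr_vert j i j' i' h
  rw [Quad.edgeVec, Quad.edgeVec, h1, h2, norm_sub_rev]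

end QuadMesh

namespace Fields

variable {w : Fields N} {T : QuadMesh N} {kind : PolyKind} {p : ℕ}

theorem InVh.continuousOn_phiMinus (hw : w.InVh T kind p) (j : Fin N) (i : Fin 4) :
    ContinuousOn (w.phiMinus T j i) (Set.Icc 0 1) := by
  obtain ⟨a, ha⟩ := (hw j).1.exists_rep
  exact ha.continuousOn_edge i

theorem InVh.continuousOn_velMinus (hw : w.InVh T kind p) (j : Fin N) (i : Fin 4) :
    ContinuousOn (w.velMinus T j i) (Set.Icc 0 1) := by
  obtain ⟨b, hb⟩ := (hw j).2.1.exists_rep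
  obtain ⟨c, hc⟩ := (hw j).2.2.exists_rep
  exact ((hb.continuousOn_edge i).mul continuousOn_const).add
    ((hc.continuousOn_edge i).mul continuousOn_const)

theorem phiPlus_of_none {j : Fin N} {i : Fin 4} (h : T.nbr j i = none) :
    w.phiPlus T j i = fun _ => 0 := by
  ext t
  simp [phiPlus, h]

theorem velPlus_of_none {j : Fin N} {i : Fin 4} (h : T.nbr j i = none) :
    w.velPlus T j i = fun _ => 0 := by
  ext t
  simp [velPlus, h]

theorem phiPlus_of_some {j : Fin N} {i : Fin 4} {j' : Fin N} {i' : Fin 4}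
    (h : T.nbr j i = some (j', i')) :
    w.phiPlus T j i = fun t => w.phiMinus T j' i' (1 - t) := by
  ext t
  simp [phiPlus, h, phiMinus, T.edgePt_nbr h]

theorem velPlus_of_some {j : Fin N} {i : Fin 4} {j' : Fin N} {i' : Fin 4}
    (h : T.nbr j i = some (j', i')) :
    w.velPlus T j i = fun t => w.velMinus T j' i' (1 - t) := by
  ext t
  simp [velPlus, h, velMinus, T.edgePt_nbr h]

theorem continuousOn_comp_one_sub {g : ℝ → ℝ} (hg : ContinuousOn g (Set.Icc 0 1)) :
    ContinuousOn (fun t => g (1 - t)) (Set.Icc 0 1) :=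
  hg.comp (by fun_prop) fun t ht => ⟨by linarith [ht.2], by linarith [ht.1]⟩

theorem InVh.continuousOn_phiPlus (hw : w.InVh T kind p) (j : Fin N) (i : Fin 4) :
    ContinuousOn (w.phiPlus T j i) (Set.Icc 0 1) := by
  rcases h : T.nbr j i with _ | ⟨j', i'⟩
  · rw [phiPlus_of_none h]
    exact continuousOn_const
  · rw [phiPlus_of_some h]
    exact continuousOn_comp_one_sub (hw.continuousOn_phiMinus j' i')

theorem InVh.continuousOn_velPlus (hw : w.InVh T kind p) (j : Fin N) (i : Fin 4) :
    ContinuousOn (w.velPlus T j i) (Set.Icc 0 1) := by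
  rcases h : T.nbr j i with _ | ⟨j', i'⟩
  · rw [velPlus_of_none h]
    exact continuousOn_const
  · rw [velPlus_of_some h]
    exact continuousOn_comp_one_sub (hw.continuousOn_velMinus j' i')

end Fields

/-- A nonnegative weight summed over the images of a partial involution. -/
theorem sum_option_le {ι : Type*} [Fintype ι] (σ : ι → Option ι)
    (hσ : ∀ x y, σ x = some y → σ y = some x) (m : ι → ℝ) (hm : ∀ x, 0 ≤ m x) :
    ∑ x, (σ x).elim 0 m ≤ ∑ x, m x := by
  classical
  have h1 : ∀ x, (σ x).elim 0 m = ∑ y, if σ x = some y then m y else 0 := by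
    intro x
    rcases h : σ x with _ | y <;> simp
  simp_rw [h1]
  rw [Finset.sum_comm]
  refine Finset.sum_le_sum fun y _ => ?_
  rcases h : σ y with _ | z
  · rw [Finset.sum_eq_zero]
    · exact hm y
    · intro x _
      rw [if_neg]
      intro hx
      rw [hσ x y hx] at h
      exact absurd h (by simp)
  · rw [Finset.sum_eq_single z]
    · split_ifs
      exacts [le_rfl, hm y]
    · intro x _ hxz
      rw [if_neg]
      intro hx
      rw [hσ x y hx] at h
      exact hxz (Option.some_injective _ h)
    · simp

/-- The exterior traces are bounded by the interior traces. -/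
theorem sum_bdryIntegral_plus_le {Φ : ℝ} (hΦ : 0 ≤ Φ) (T : QuadMesh N) (w : Fields N) :
    ∑ j, (T.elem j).bdryIntegral (fun i t => w.phiPlus T j i t ^ 2 + Φ * w.velPlus T j i t ^ 2)
      ≤ skelNormSq Φ T w := by
  let m : Fin N × Fin 4 → ℝ := fun x => ‖(T.elem x.1).edgeVec x.2‖ *
    ∫ t in (0 : ℝ)..1, (w.phiMinus T x.1 x.2 t ^ 2 + Φ * w.velMinus T x.1 x.2 t ^ 2)
  have hm : ∀ x, 0 ≤ m x := fun x => mul_nonneg (norm_nonneg _)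
    (intervalIntegral.integral_nonneg zero_le_one fun t _ => by positivity)
  have h := sum_option_le (fun x : Fin N × Fin 4 => T.nbr x.1 x.2)
    (fun x y h => T.nbr_symm x.1 x.2 y.1 y.2 h) m hm
  rw [Fintype.sum_prod_type, Fintype.sum_prod_type] at h
  refine le_trans (le_of_eq ?_) h
  refine Finset.sum_congr rfl fun j _ => Finset.sum_congr rfl fun i _ => ?_
  rcases hn : T.nbr j i with _ | ⟨j', i'⟩
  · simp [Fields.phiPlus_of_none hn, Fields.velPlus_of_none hn]
  · simp only [Option.elim, Fields.phiPlus_of_some hn, Fields.velPlus_of_some hn, m,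
      T.norm_edgeVec_nbr hn]
    have := intervalIntegral.integral_comp_sub_left (a := 0) (b := 1)
      (fun t => w.phiMinus T j' i' t ^ 2 + Φ * w.velMinus T j' i' t ^ 2) 1
    simp only [sub_self, sub_zero] at this
    rw [this]

/-! ### Estimates for one step of the iteration -/

/-- The energy estimate on one element. -/
theorem IsStep.energy_le {P : Params} {T : QuadMesh N} {kind : PolyKind} {p : ℕ}
    {old new : Fields N} (hstep : IsStep P T kind p old new) (hold : old.InVh T kind p)
    (hnew : new.InVh T kind p) (hΦ : 0 < P.Φ) {ε : ℝ} (hε : 0 < ε) (j : Fin N) :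
    1 / P.Δt * (∫ x in (T.elem j).openElem, new.φ j x ^ 2)
      + (P.γ + 1 / P.Δt) * (P.Φ * ((∫ x in (T.elem j).openElem, new.u j x ^ 2)
        + ∫ x in (T.elem j).openElem, new.v j x ^ 2))
      + (2 * √P.Φ - (P.Φ + √P.Φ) * ε) / 4
        * (T.elem j).bdryIntegral (fun i t => new.phiMinus T j i t ^ 2)
      + (2 * √P.Φ - (1 + √P.Φ) * ε) / 4
        * (P.Φ * (T.elem j).bdryIntegral (fun i t => new.velMinus T j i t ^ 2))
      ≤ constA P.Φ ε * (T.elem j).bdryIntegral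
        (fun i t => old.phiPlus T j i t ^ 2 + P.Φ * old.velPlus T j i t ^ 2) := by
  obtain ⟨hsφ, hsu, hsv⟩ := hnew j
  obtain ⟨a, ha⟩ := hsφ.exists_rep
  obtain ⟨b, hb⟩ := hsu.exists_rep
  obtain ⟨c, hc⟩ := hsv.exists_rep
  have cx := hnew.continuousOn_phiMinus j
  have cy := hnew.continuousOn_velMinus j
  have cx' := hold.continuousOn_phiPlus j
  have cy' := hold.continuousOn_velPlus j
  have cψ : ∀ i, ContinuousOn (phiHat P T old new j i) (Set.Icc 0 1) := by
    intro i
    have := cx i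
    have := cy i
    have := cx' i
    have := cy' i
    unfold phiHat
    fun_prop
  have hE := (T.elem j).energy_identity P ha hb hc cψ (hstep j _ hsφ).1 (hstep j _ hsu).2.1
    (hstep j _ hsv).2.2
  have hY : (T.elem j).bdryIntegral (fun i t =>
        (2 * √P.Φ - (P.Φ + √P.Φ) * ε) / 4 * new.phiMinus T j i t ^ 2
          + (2 * √P.Φ - (1 + √P.Φ) * ε) / 4 * (P.Φ * new.velMinus T j i t ^ 2))
      ≤ (T.elem j).bdryIntegral (fun i t =>
        (√P.Φ * (new.phiMinus T j i t - phiHat P T old new j i t) * new.phiMinus T j i t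
          + P.Φ * phiHat P T old new j i t * new.velMinus T j i t)
        + constA P.Φ ε * (old.phiPlus T j i t ^ 2 + P.Φ * old.velPlus T j i t ^ 2)) := by
    refine (T.elem j).bdryIntegral_mono (fun i => ?_) (fun i => ?_) fun i t _ =>
      flux_lower_bound hΦ hε _ _ _ _
    all_goals
      have := cx i
      have := cy i
      have := cx' i
      have := cy' i
      have := cψ i
      fun_prop
  rw [(T.elem j).bdryIntegral_add, (T.elem j).bdryIntegral_add,
    (T.elem j).bdryIntegral_const_mul, (T.elem j).bdryIntegral_const_mul,
    (T.elem j).bdryIntegral_const_mul, (T.elem j).bdryIntegral_const_mul] at hY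
  · have e : (T.elem j).bdryIntegral (fun i t =>
        √P.Φ * (new.phiMinus T j i t - phiHat P T old new j i t) * new.phiMinus T j i t
          + P.Φ * phiHat P T old new j i t * new.velMinus T j i t) = _ :=
      eq_neg_of_add_eq_zero_right hE
    rw [e] at hY
    linarith
  all_goals
    intro i
    have := cx i
    have := cy i
    have := cx' i
    have := cy' i
    have := cψ i
    fun_prop

/-- The trace inequality for the normal velocity. -/
theorem Fields.InVh.velMinus_trace_le {w : Fields N} {T : QuadMesh N} {kind : PolyKind} {p : ℕ}
    (hw : w.InVh T kind p) (j : Fin N) {θ : ℝ} (hθ : 0 ≤ θ)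
    (htr : ∀ f q, (T.elem j).Rep p f q →
      θ * (T.elem j).bdryIntegral (fun i t => f ((T.elem j).edgePt i t) ^ 2) ≤
        ∫ x in (T.elem j).openElem, f x ^ 2) :
    θ * (T.elem j).bdryIntegral (fun i t => w.velMinus T j i t ^ 2) ≤
      (∫ x in (T.elem j).openElem, w.u j x ^ 2) + ∫ x in (T.elem j).openElem, w.v j x ^ 2 := by
  obtain ⟨b, hb⟩ := (hw j).2.1.exists_rep
  obtain ⟨c, hc⟩ := (hw j).2.2.exists_rep
  refine le_trans ?_ (add_le_add (htr _ _ hb) (htr _ _ hc))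
  rw [← mul_add, ← (T.elem j).bdryIntegral_add
    (g := fun i t => w.u j ((T.elem j).edgePt i t) ^ 2)
    (g' := fun i t => w.v j ((T.elem j).edgePt i t) ^ 2)
    (fun i => (hb.continuousOn_edge i).pow 2) (fun i => (hc.continuousOn_edge i).pow 2)]
  refine mul_le_mul_of_nonneg_left ((T.elem j).bdryIntegral_mono
    (fun i => (hw.continuousOn_velMinus j i).pow 2)
    (fun i => ((hb.continuousOn_edge i).pow 2).add ((hc.continuousOn_edge i).pow 2))
    fun i t _ => ?_) hθ
  have hn := (T.elem j).normal_sq i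
  simp only [Fields.velMinus]
  set U := w.u j ((T.elem j).edgePt i t)
  set V := w.v j ((T.elem j).edgePt i t)
  set m := (T.elem j).normal i 0
  set n := (T.elem j).normal i 1
  have : U ^ 2 + V ^ 2 - (U * m + V * n) ^ 2 = (U * n - V * m) ^ 2 := by
    linear_combination -(U ^ 2 + V ^ 2) * hn
  linarith [sq_nonneg (U * n - V * m)]

theorem skelNormSq_nonneg {Φ : ℝ} (hΦ : 0 ≤ Φ) (T : QuadMesh N) (w : Fields N) :
    0 ≤ skelNormSq Φ T w :=
  Finset.sum_nonneg fun j _ => (T.elem j).bdryIntegral_nonneg fun i t _ => by positivity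

theorem volNormSq_nonneg {Φ : ℝ} (hΦ : 0 ≤ Φ) (T : QuadMesh N) (w : Fields N) :
    0 ≤ volNormSq Φ T w :=
  Finset.sum_nonneg fun j _ => integral_nonneg fun x => by positivity

theorem constA_nonneg {Φ ε : ℝ} (hε : 0 < ε) : 0 ≤ constA Φ ε := by
  have : (0 : ℝ) ≤ max 1 Φ := le_max_of_le_left zero_le_one
  unfold constA
  positivity

theorem constG_nonneg {Φ ε : ℝ} (hε : 0 < ε) : 0 ≤ constG Φ ε := by
  have : (0 : ℝ) ≤ max 1 Φ := le_max_of_le_left zero_le_one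
  unfold constG
  positivity

/-- One step of the iteration: the new traces are controlled by the old ones, and the new iterate
is controlled by the old and new traces. -/
theorem IsStep.estimates {κ c : ℝ} (hc : 0 ≤ c) (hcκ : 4 * c ≤ κ) {P : Params} {T : QuadMesh N}
    (hT : T.IsRegular κ) {kind : PolyKind} {p : ℕ} {old new : Fields N}
    (hstep : IsStep P T kind p old new) (hold : old.InVh T kind p) (hnew : new.InVh T kind p)
    (hΦ : 0 < P.Φ) (hγ : 0 ≤ P.γ) (hΔ : 0 < P.Δt) {ε : ℝ} (hε : 0 < ε) :
    constB P c T.meshSize p ε * skelNormSq P.Φ T new ≤ constA P.Φ ε * skelNormSq P.Φ T old ∧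
      1 / P.Δt * volNormSq P.Φ T new ≤
        constA P.Φ ε * skelNormSq P.Φ T old + constG P.Φ ε * skelNormSq P.Φ T new := by
  have hA := constA_nonneg (Φ := P.Φ) hε
  have hplus := mul_le_mul_of_nonneg_left (sum_bdryIntegral_plus_le hΦ.le T old) hA
  have hS := Real.sqrt_nonneg P.Φ
  have key : ∀ j,
      constB P c T.meshSize p ε * (T.elem j).bdryIntegral
          (fun i t => new.phiMinus T j i t ^ 2 + P.Φ * new.velMinus T j i t ^ 2)
        ≤ constA P.Φ ε * (T.elem j).bdryIntegral
          (fun i t => old.phiPlus T j i t ^ 2 + P.Φ * old.velPlus T j i t ^ 2) ∧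
      1 / P.Δt * (∫ x in (T.elem j).openElem,
          (new.φ j x ^ 2 + P.Φ * (new.u j x ^ 2 + new.v j x ^ 2)))
        ≤ constA P.Φ ε * (T.elem j).bdryIntegral
          (fun i t => old.phiPlus T j i t ^ 2 + P.Φ * old.velPlus T j i t ^ 2)
        + constG P.Φ ε * (T.elem j).bdryIntegral
          (fun i t => new.phiMinus T j i t ^ 2 + P.Φ * new.velMinus T j i t ^ 2) := by
    intro j
    have hh : 0 < T.meshSize :=
      ((T.elem j).norm_edgeVec_pos 0).trans_le (T.norm_edgeVec_le j 0)
    set θ : ℝ := c * T.meshSize / (((p : ℝ) + 1) * ((p : ℝ) + 2)) with hθ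
    have hθ0 : 0 ≤ θ := by positivity
    have htr : ∀ f q, (T.elem j).Rep p f q →
        θ * (T.elem j).bdryIntegral (fun i t => f ((T.elem j).edgePt i t) ^ 2) ≤
          ∫ x in (T.elem j).openElem, f x ^ 2 := fun f q hf =>
      hf.trace_le hh hc hcκ (T.norm_edgeVec_le j) (hT j)
    have hE := hstep.energy_le hold hnew hΦ hε j
    have tv := hnew.velMinus_trace_le j hθ0 htr
    obtain ⟨a, ra⟩ := (hnew j).1.exists_rep
    obtain ⟨b, rb⟩ := (hnew j).2.1.exists_rep
    obtain ⟨d, rd⟩ := (hnew j).2.2.exists_rep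
    have tφ : θ * (T.elem j).bdryIntegral (fun i t => new.phiMinus T j i t ^ 2) ≤ _ := htr _ _ ra
    have iφ : IntegrableOn (fun x => new.φ j x ^ 2) (T.elem j).openElem := by
      simpa only [pow_two] using ra.integrableOn_mul ra
    have iu : IntegrableOn (fun x => new.u j x ^ 2) (T.elem j).openElem := by
      simpa only [pow_two] using rb.integrableOn_mul rb
    have iv : IntegrableOn (fun x => new.v j x ^ 2) (T.elem j).openElem := by
      simpa only [pow_two] using rd.integrableOn_mul rd
    have iuv : IntegrableOn (fun x => P.Φ * (new.u j x ^ 2 + new.v j x ^ 2)) (T.elem j).openElem :=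
      (iu.add iv).const_mul P.Φ
    rw [(T.elem j).bdryIntegral_add (g := fun i t => new.phiMinus T j i t ^ 2)
      (g' := fun i t => P.Φ * new.velMinus T j i t ^ 2)
      (fun i => (hnew.continuousOn_phiMinus j i).pow 2)
      (fun i => continuousOn_const.mul ((hnew.continuousOn_velMinus j i).pow 2)),
      (T.elem j).bdryIntegral_const_mul, integral_add iφ iuv, integral_const_mul,
      integral_add iu iv]
    have m1 : 0 ≤ (T.elem j).bdryIntegral (fun i t => new.phiMinus T j i t ^ 2) :=
      (T.elem j).bdryIntegral_nonneg fun i t _ => sq_nonneg _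
    have m2 : 0 ≤ (T.elem j).bdryIntegral (fun i t => new.velMinus T j i t ^ 2) :=
      (T.elem j).bdryIntegral_nonneg fun i t _ => sq_nonneg _
    have nu : 0 ≤ ∫ x in (T.elem j).openElem, new.u j x ^ 2 := integral_nonneg fun x => sq_nonneg _
    have nv : 0 ≤ ∫ x in (T.elem j).openElem, new.v j x ^ 2 := integral_nonneg fun x => sq_nonneg _
    generalize (T.elem j).bdryIntegral (fun i t => new.phiMinus T j i t ^ 2) = M₁ at *
    generalize (T.elem j).bdryIntegral (fun i t => new.velMinus T j i t ^ 2) = M₂ at *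
    generalize (∫ x in (T.elem j).openElem, new.φ j x ^ 2) = Iφ at *
    generalize (∫ x in (T.elem j).openElem, new.u j x ^ 2) = Iu at *
    generalize (∫ x in (T.elem j).openElem, new.v j x ^ 2) = Iv at *
    have hB₁ : constB P c T.meshSize p ε ≤
        1 / P.Δt * θ + (2 * √P.Φ - (P.Φ + √P.Φ) * ε) / 4 := by
      refine (min_le_left _ _).trans (le_of_eq ?_)
      rw [constB₁, hθ]
      congr 1
      field_simp
    have hB₂ : constB P c T.meshSize p ε ≤
        (P.γ + 1 / P.Δt) * θ + (2 * √P.Φ - (1 + √P.Φ) * ε) / 4 := min_le_right _ _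
    have hG₁ : -constG P.Φ ε ≤ (2 * √P.Φ - (P.Φ + √P.Φ) * ε) / 4 := by
      have := mul_le_mul_of_nonneg_right (le_max_right 1 P.Φ) hε.le
      unfold constG
      linarith
    have hG₂ : -constG P.Φ ε ≤ (2 * √P.Φ - (1 + √P.Φ) * ε) / 4 := by
      have := mul_le_mul_of_nonneg_right (le_max_left 1 P.Φ) hε.le
      unfold constG
      linarith
    have hΔi : 0 ≤ 1 / P.Δt := by positivity
    have hM₂ : 0 ≤ P.Φ * M₂ := by positivity
    constructor
    · have h1 := mul_le_mul_of_nonneg_right hB₁ m1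
      have h2 := mul_le_mul_of_nonneg_right hB₂ hM₂
      have h3 := mul_le_mul_of_nonneg_left tφ hΔi
      have h4 := mul_le_mul_of_nonneg_left tv (by positivity : 0 ≤ (P.γ + 1 / P.Δt) * P.Φ)
      linarith
    · have h1 := mul_le_mul_of_nonneg_right hG₁ m1
      have h2 := mul_le_mul_of_nonneg_right hG₂ hM₂
      have h3 : 0 ≤ P.γ * (P.Φ * (Iu + Iv)) := by positivity
      linarith
  constructor
  · refine le_trans ?_ hplus
    rw [skelNormSq, Finset.mul_sum, Finset.mul_sum]
    exact Finset.sum_le_sum fun j _ => (key j).1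
  · refine le_trans ?_ (add_le_add_left hplus _)
    rw [skelNormSq, volNormSq, Finset.mul_sum, Finset.mul_sum, Finset.mul_sum,
      ← Finset.sum_add_distrib]
    exact Finset.sum_le_sum fun j _ => (key j).2

end IHDG

end

theorem mainTheorem2 (κ : ℝ) (hκ : 0 < κ) :
    ∃ c : ℝ, 0 < c ∧ c ≤ 1 ∧
      ∀ (N : ℕ) (T : IHDG.QuadMesh N), T.IsRegular κ →
      ∀ (P : IHDG.Params), 0 < P.Φ → 0 ≤ P.γ → 0 < P.Δt →
      ∀ (kind : IHDG.PolyKind) (p : ℕ) (ε : ℝ), 0 < ε →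
        0 < IHDG.constB P c T.meshSize p ε →
        IHDG.constC P c T.meshSize p ε < 1 →
      ∀ w : ℕ → IHDG.Fields N, IHDG.IsIteration P T kind p w →
        (∀ k : ℕ, IHDG.skelNormSq P.Φ T (w k) ≤
          IHDG.constC P c T.meshSize p ε ^ k * IHDG.skelNormSq P.Φ T (w 0)) ∧
        (∀ k : ℕ, 1 ≤ k → IHDG.volNormSq P.Φ T (w k) ≤
          P.Δt * (IHDG.constA P.Φ ε + IHDG.constG P.Φ ε * IHDG.constC P c T.meshSize p ε)
            * IHDG.constC P c T.meshSize p ε ^ (k - 1) * IHDG.skelNormSq P.Φ T (w 0)) ∧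
        Filter.Tendsto (fun k => IHDG.skelNormSq P.Φ T (w k)) Filter.atTop (nhds 0) ∧
        Filter.Tendsto (fun k => IHDG.volNormSq P.Φ T (w k)) Filter.atTop (nhds 0) := by
  refine ⟨min 1 (κ / 4), by positivity, min_le_left _ _, ?_⟩
  intro N T hT P hΦ hγ hΔ kind p ε hε hB hC w hw
  have hc0 : 0 ≤ min 1 (κ / 4) := by positivity
  have hcκ : 4 * min 1 (κ / 4) ≤ κ := by linarith [min_le_right 1 (κ / 4)]
  generalize min 1 (κ / 4) = c at *
  have hest := fun k => (hw.2 k).estimates hc0 hcκ hT (hw.1 k) (hw.1 (k + 1)) hΦ hγ hΔ hε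
  have hA := IHDG.constA_nonneg (Φ := P.Φ) hε
  have hG := IHDG.constG_nonneg (Φ := P.Φ) hε
  have hC0 : 0 ≤ IHDG.constC P c T.meshSize p ε := div_nonneg hA hB.le
  have hCdef : IHDG.constC P c T.meshSize p ε =
      IHDG.constA P.Φ ε / IHDG.constB P c T.meshSize p ε := rfl
  have hs0 := fun k => IHDG.skelNormSq_nonneg hΦ.le T (w k)
  have hv0 := fun k => IHDG.volNormSq_nonneg hΦ.le T (w k)
  have hstep : ∀ k, IHDG.skelNormSq P.Φ T (w (k + 1)) ≤
      IHDG.constC P c T.meshSize p ε * IHDG.skelNormSq P.Φ T (w k) := by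
    intro k
    rw [hCdef, div_mul_eq_mul_div, le_div_iff₀ hB, mul_comm]
    exact (hest k).1
  generalize IHDG.constC P c T.meshSize p ε = C at *
  have hskel : ∀ k : ℕ, IHDG.skelNormSq P.Φ T (w k) ≤ C ^ k * IHDG.skelNormSq P.Φ T (w 0) := by
    intro k
    induction k with
    | zero => simp
    | succ k ih =>
      refine (hstep k).trans ((mul_le_mul_of_nonneg_left ih hC0).trans_eq ?_)
      ring
  have hvol : ∀ k : ℕ, IHDG.volNormSq P.Φ T (w (k + 1)) ≤
      P.Δt * (IHDG.constA P.Φ ε + IHDG.constG P.Φ ε * C) * C ^ k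
        * IHDG.skelNormSq P.Φ T (w 0) := by
    intro k
    have h1 := (hest k).2
    rw [one_div, inv_mul_le_iff₀ hΔ] at h1
    refine h1.trans ?_
    have h2 := mul_le_mul_of_nonneg_left (hstep k) hG
    calc P.Δt * (IHDG.constA P.Φ ε * IHDG.skelNormSq P.Φ T (w k)
          + IHDG.constG P.Φ ε * IHDG.skelNormSq P.Φ T (w (k + 1)))
        ≤ P.Δt * (IHDG.constA P.Φ ε * IHDG.skelNormSq P.Φ T (w k)
          + IHDG.constG P.Φ ε * (C * IHDG.skelNormSq P.Φ T (w k))) := by gcongr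
      _ = P.Δt * (IHDG.constA P.Φ ε + IHDG.constG P.Φ ε * C)
          * IHDG.skelNormSq P.Φ T (w k) := by ring
      _ ≤ P.Δt * (IHDG.constA P.Φ ε + IHDG.constG P.Φ ε * C)
          * (C ^ k * IHDG.skelNormSq P.Φ T (w 0)) :=
        mul_le_mul_of_nonneg_left (hskel k) (by positivity)
      _ = _ := by ring
  have hpow := tendsto_pow_atTop_nhds_zero_of_lt_one hC0 hC
  refine ⟨hskel, fun k hk => ?_, ?_, ?_⟩
  · obtain ⟨k, rfl⟩ := Nat.exists_eq_add_of_le' hk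
    exact hvol k
  · refine squeeze_zero hs0 hskel ?_
    simpa using hpow.mul_const (IHDG.skelNormSq P.Φ T (w 0))
  · rw [← Filter.tendsto_add_atTop_iff_nat 1]
    refine squeeze_zero (fun k => hv0 (k + 1)) hvol ?_
    simpa using (hpow.const_mul (P.Δt * (IHDG.constA P.Φ ε + IHDG.constG P.Φ ε * C))).mul_const
      (IHDG.skelNormSq P.Φ T (w 0))
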